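/- Let $\mathbb{T}=\mathbb{R}/\mathbb{Z}$ be the circle with its quotient distance $d$, let $(r_n)_{n\ge1}$ be a sequence of real numbers in $(0,1]$, and assume that there is a real $\rho\in(0,\infty)$ such that $\sum_n r_n^{\nu}=\infty$ for every $\nu<\rho$ and $\sum_n r_n^{\nu}<\infty$ for every $\nu>\rho$. Let $X=(X_n)_{n\ge1}$ be a sequence of independent random points of $\mathbb{T}$, each distributed according to the Lebesgue probability measure on $\mathbb{T}$. For $\xi\in\mathbb{T}$, set $$\nu_{X,r}(\xi)=\sup\{\nu\ge0 \;|\; d(\xi,X_n)<r_n^{\nu}\text{ for infinitely many }n\ge1\}\in[0,\infty].$$ Let $\gamma\in(0,1]$ and let $G$ be a nonempty compact subset of $\mathbb{T}$ that is Ahlfors regular with dimension $\gamma$, that is, there is a real $c>0$ such that $$\frac{t^{\gamma}}{c}\le\mathcal{H}^{\gamma}(G\cap B(x,t))\le c\,t^{\gamma}\qquad\text{for all }x\in G\text{ and }0<t\le\tfrac12,$$ where $\mathcal{H}^{\gamma}$ is the $\gamma$-dimensional Hausdorff measure and $B(x,t)$ is the open arc centered at $x$ with length $2t$. Write $\dim_H$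 for the Hausdorff dimension, with the convention $\dim_H\emptyset=-\infty$, and let $\rho/(1-\gamma)=\infty$ when $\gamma=1$. Then: 1. almost surely, for every $\xi\in G$, $$\rho\le\nu_{X,r}(\xi)\le\frac{\rho}{1-\gamma};$$ 2. for every real number $\nu\ge\rho$ such that $(1-\gamma)\nu\le\rho$, almost surely, $$\dim_H\{\xi\in G\;|\;\nu_{X,r}(\xi)\ge\nu\}=\frac{\rho}{\nu}+\gamma-1;$$ in particular, in the critical case $(1-\gamma)\nu=\rho$, this set is almost surely nonempty, with Hausdorff dimension zero. -/

import Mathlib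

open MeasureTheory ProbabilityTheory Set Filter
open scoped ENNReal NNReal

/-- `E(x, r)`: the points of the circle `ℝ/ℤ` whose quotient distance to `x n` is less than `r n`
for infinitely many `n`. -/
def limsupSet (x : ℕ → UnitAddCircle) (r : ℕ → ℝ) : Set UnitAddCircle :=
  {ξ | ∃ᶠ n in atTop, dist ξ (x n) < r n}

/-- The exponent `ν_{x,r}(ξ) = sup {ν ≥ 0 | ξ ∈ E(x, r^ν)}`, with value in `[0, ∞]`. -/
noncomputable def approxExponent (x : ℕ → UnitAddCircle) (r : ℕ → ℝ) (ξ : UnitAddCircle) : ℝ≥0∞ :=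
  ⨆ (ν : ℝ≥0) (_ : ξ ∈ limsupSet x (fun n => r n ^ (ν : ℝ))), (ν : ℝ≥0∞)

/-- The Hausdorff dimension of a subset of the circle, with the convention `dim_H ∅ = -∞`. -/
noncomputable def hausdorffDim (E : Set UnitAddCircle) : EReal :=
  open Classical in if E = ∅ then ⊥ else ((dimH E : ℝ≥0∞) : EReal)

/-- A compact subset `G` of the circle is Ahlfors regular with dimension `γ ∈ (0, 1]` if the
`γ`-dimensional Hausdorff measure of the trace on `G` of every open arc centered in `G` with
length `2 * t` is comparable with `t ^ γ`. The circle has length one, so arcs with length `2 * t`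
are those with `0 < t ≤ 1 / 2`. -/
structure IsAhlforsRegular (G : Set UnitAddCircle) (γ : ℝ) : Prop where
  isCompact : IsCompact G
  dim_pos : 0 < γ
  dim_le_one : γ ≤ 1
  exists_const : ∃ c : ℝ, 0 < c ∧ ∀ x ∈ G, ∀ t : ℝ, 0 < t → t ≤ 1 / 2 →
    ENNReal.ofReal (t ^ γ / c) ≤ Measure.hausdorffMeasure γ (G ∩ Metric.ball x t) ∧
    Measure.hausdorffMeasure γ (G ∩ Metric.ball x t) ≤ ENNReal.ofReal (c * t ^ γ)

/-! Three mechanisms drive the proof. Lower bound on the exponent. If `ν < a < b < ρ`, divergence of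
`∑ r n ^ b` yields arbitrarily small `t` with at least `t ^ (-a)` late indices satisfying `r n ≥ t`.
That many uniform arcs of radius `t ^ ν` fail to cover the circle with probability at most `2 t ^
(-ν) exp (-t ^ (-(a - ν)))`, which tends to zero (`ae_forall_mem_limsupSet`). Upper bounds. The
`t`-neighbourhood of `G` has length `O(t ^ (1 - γ))`, so the mean of `∑ r n ^ (ν s)` over the `n`
whose arc of radius `r n ^ ν` meets `G` is of order `∑ r n ^ (ν (s + 1 - γ))`
(`ae_tsum_mem_thickening_lt_top`). Finiteness with `s = 0` is Borel–Cantelli and bounds the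
exponent; with `s > 0` these arcs form economical covers and bound the dimension. Lower bound on the
dimension. Let `μ` be Hausdorff measure on `G`. Finite blocks of indices, each beyond the previous
ones, give independent random densities of mean one carried by arcs of radius `r n ^ κ k`, where `κ
k` increases to `ν`. The products `M k` have nested closed supports. Divergence of `∑ r n ^ (κ k (1
+ s - γ))` allows each block to add arbitrarily little to the `s`-energy of the correlations
(`exists_block_of_not_summable`, `exists_cascade_seq`). Chebyshev and Markov then show that, outside
an event of small probability, infinitely many of the measures `M k μ` have mass bounded below and
energy bounded above. By compactness the intersection of the supports is nonempty of dimension at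
least `s` (`le_dimH_iInter_of_rieszEnergy_le`), and its points have exponent at least `ν`. Only `κ k
< ν` is used, so `s = ρ / ν + γ - 1` itself is admissible when it is less than `γ`; this includes
the critical value `s = 0`. -/

/-- The `s`-energy of a measure. -/
noncomputable def rieszEnergy {Y : Type*} [EMetricSpace Y] [MeasurableSpace Y] (s : ℝ)
    (m : Measure Y) : ℝ≥0∞ :=
  ∫⁻ x, ∫⁻ y, edist x y ^ (-s) ∂m ∂m

/-! ### Energy and Hausdorff dimension of decreasing intersections. -/

section Energy

variable {Y : Type*} [EMetricSpace Y]

theorem one_le_rpow_mul_edist_rpow_neg {s : ℝ} (hs : 0 < s) {x y : Y} {d : ℝ≥0∞}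
    (hd0 : d ≠ 0) (hd : d ≠ ∞) (h : edist x y ≤ d) : 1 ≤ d ^ s * edist x y ^ (-s) := by
  have h1 : d ^ s ≠ 0 := by simp [ENNReal.rpow_eq_zero_iff, hd0, hd]
  have h2 : d ^ s ≠ ∞ := ENNReal.rpow_ne_top_of_nonneg hs.le hd
  rw [ENNReal.rpow_neg, ← div_eq_mul_inv]
  by_cases h0 : edist x y ^ s = 0
  · rw [h0, ENNReal.div_zero h1]; exact le_top
  · rw [ENNReal.le_div_iff_mul_le (Or.inl h0) (Or.inr h2), one_mul]
    exact ENNReal.rpow_le_rpow h hs.le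

variable [MeasurableSpace Y]

/-- The kernel is at least `d ^ (-s)` on `D × D`, whence `m D ^ 2 ≤ d ^ s * J` with `J` the energy
integral over `D`; either `m D ≤ l * d ^ s`, or one factor `m D` cancels. The linear form with a
fixed `l` makes the bound additive over disjoint pieces. -/
theorem measure_le_of_ediam_le (m : Measure Y) [IsFiniteMeasure m] {s : ℝ} (hs : 0 < s) {D : Set Y}
    (hD : MeasurableSet D) {d : ℝ≥0∞} (hd0 : d ≠ 0) (hd : d ≠ ∞) (h : Metric.ediam D ≤ d)
    {l : ℝ≥0∞} (hl0 : l ≠ 0) (hl : l ≠ ∞) :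
    m D ≤ l * d ^ s + l⁻¹ * ∫⁻ x in D, ∫⁻ y, edist x y ^ (-s) ∂m ∂m := by
  set J := ∫⁻ x in D, ∫⁻ y, edist x y ^ (-s) ∂m ∂m with hJ
  have h2 : d ^ s ≠ ∞ := ENNReal.rpow_ne_top_of_nonneg hs.le hd
  have key : m D * m D ≤ d ^ s * J := by
    calc m D * m D = ∫⁻ _ in D, ∫⁻ _ in D, 1 ∂m ∂m := by simp
      _ ≤ ∫⁻ x in D, d ^ s * ∫⁻ y, edist x y ^ (-s) ∂m ∂m := by
          refine setLIntegral_mono' hD fun x hx => ?_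
          rw [← lintegral_const_mul' _ _ h2]
          refine (setLIntegral_mono' hD fun y hy => ?_).trans (setLIntegral_le_lintegral D _)
          exact one_le_rpow_mul_edist_rpow_neg hs hd0 hd
            ((Metric.edist_le_ediam_of_mem hx hy).trans h)
      _ = d ^ s * J := by rw [lintegral_const_mul' _ _ h2]
  by_cases hc : m D ≤ l * d ^ s
  · exact hc.trans le_self_add
  refine le_trans ?_ (le_add_self : l⁻¹ * J ≤ _)
  have hm : m D ≠ ∞ := measure_ne_top m D
  have hm0 : m D ≠ 0 := fun h0 => hc (by simp [h0])
  have h3 : d ^ s ≤ l⁻¹ * m D := by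
    have := (not_le.1 hc).le
    rw [← ENNReal.div_eq_inv_mul, ENNReal.le_div_iff_mul_le (Or.inl hl0) (Or.inl hl), mul_comm]
    exact this
  have h4 : m D * m D ≤ m D * (l⁻¹ * J) :=
    calc m D * m D ≤ d ^ s * J := key
      _ ≤ l⁻¹ * m D * J := by gcongr
      _ = m D * (l⁻¹ * J) := by ring
  exact (ENNReal.mul_le_mul_iff_right hm0 hm).1 h4

theorem measure_iUnion_le_of_ediam_le (m : Measure Y) [IsFiniteMeasure m] {s : ℝ} (hs : 0 < s)
    {U : ℕ → Set Y} (hU : ∀ n, MeasurableSet (U n)) {d : ℕ → ℝ≥0∞} (hd0 : ∀ n, d n ≠ 0)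
    (hd : ∀ n, d n ≠ ∞) (h : ∀ n, Metric.ediam (U n) ≤ d n)
    {l : ℝ≥0∞} (hl0 : l ≠ 0) (hl : l ≠ ∞) :
    m (⋃ n, U n) ≤ l * ∑' n, d n ^ s + l⁻¹ * rieszEnergy s m := by
  have hM : ∀ n, MeasurableSet (disjointed U n) := fun n => .disjointed hU n
  rw [← iUnion_disjointed, measure_iUnion (disjoint_disjointed U) hM]
  calc ∑' n, m (disjointed U n)
      ≤ ∑' n, (l * d n ^ s +
          l⁻¹ * ∫⁻ x in disjointed U n, ∫⁻ y, edist x y ^ (-s) ∂m ∂m) :=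
        ENNReal.tsum_le_tsum fun n => measure_le_of_ediam_le m hs (hM n) (hd0 n) (hd n)
          ((Metric.ediam_mono (disjointed_le U n)).trans (h n)) hl0 hl
    _ = l * ∑' n, d n ^ s +
          l⁻¹ * ∫⁻ x in ⋃ n, disjointed U n, ∫⁻ y, edist x y ^ (-s) ∂m ∂m := by
        rw [ENNReal.tsum_add, ENNReal.tsum_mul_left, ENNReal.tsum_mul_left,
          lintegral_iUnion hM (disjoint_disjointed U)]
    _ ≤ _ := by
        gcongr
        exact setLIntegral_le_lintegral _ _

/-- A null set for the Hausdorff measure admits economical coverings by open sets. -/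
theorem exists_open_cover_of_hausdorffMeasure_eq_zero [BorelSpace Y] {s : ℝ} (hs : 0 < s)
    {K : Set Y} (hK : Measure.hausdorffMeasure s K = 0) {ε : ℝ≥0∞} (hε : ε ≠ 0) :
    ∃ (U : ℕ → Set Y) (d : ℕ → ℝ≥0∞), (∀ n, IsOpen (U n)) ∧ K ⊆ ⋃ n, U n ∧ (∀ n, d n ≠ 0) ∧
      (∀ n, d n ≠ ∞) ∧ (∀ n, Metric.ediam (U n) ≤ d n) ∧ ∑' n, d n ^ s < ε := by
  rw [Measure.hausdorffMeasure_apply] at hK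
  -- Scale `1` serves only to keep the diameters of the covering sets finite.
  have h1 := (iSup_eq_bot.1 hK) 1
  have h2 := (iSup_eq_bot.1 h1) one_pos
  have h3 := h2.trans_lt (ENNReal.half_pos hε).bot_lt
  simp only [iInf_lt_iff] at h3
  obtain ⟨t, hcov, hdiam, hsum⟩ := h3
  obtain ⟨e, he0, hesum⟩ := ENNReal.exists_pos_sum_of_countable (ENNReal.half_pos hε).ne' ℕ
  have hsup : ∀ n, (⨆ (_ : (t n).Nonempty), Metric.ediam (t n) ^ s) = Metric.ediam (t n) ^ s := by
    intro n
    rcases (t n).eq_empty_or_nonempty with h | h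
    · simp [h, ENNReal.zero_rpow_of_pos hs]
    · simp [h]
  simp only [hsup] at hsum
  have hfin : ∀ n, Metric.ediam (t n) ≠ ∞ := fun n => ((hdiam n).trans_lt ENNReal.one_lt_top).ne
  -- Thickening by `η` makes the sets open and the bounds `d n` positive, even for singletons, at a
  -- cost `e n` per set.
  have hη : ∀ n, ∃ η : ℝ≥0, 0 < η ∧
      (Metric.ediam (t n) + 2 * η) ^ s < Metric.ediam (t n) ^ s + e n := by
    intro n
    have hcont : Continuous fun η : ℝ≥0 => (Metric.ediam (t n) + 2 * (η : ℝ≥0∞)) ^ s := by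
      refine (ENNReal.continuous_rpow_const).comp (continuous_const.add ?_)
      exact (ENNReal.continuous_const_mul (by simp)).comp ENNReal.continuous_coe
    have hlt : (Metric.ediam (t n) + 2 * ((0 : ℝ≥0) : ℝ≥0∞)) ^ s <
        Metric.ediam (t n) ^ s + e n := by
      simp only [ENNReal.coe_zero, mul_zero, add_zero]
      exact ENNReal.lt_add_right (ENNReal.rpow_ne_top_of_nonneg hs.le (hfin n))
        (by simpa using (he0 n).ne')
    have hev := hcont.continuousAt.eventually (Iio_mem_nhds hlt)
    have hev' : ∀ᶠ η : ℝ≥0 in nhdsWithin 0 (Ioi 0), (Metric.ediam (t n) + 2 * (η : ℝ≥0∞)) ^ s <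
        Metric.ediam (t n) ^ s + e n := hev.filter_mono nhdsWithin_le_nhds
    obtain ⟨η, h1, h2⟩ := (hev'.and self_mem_nhdsWithin).exists
    exact ⟨η, h2, h1⟩
  choose η hη0 hη using hη
  refine ⟨fun n => Metric.thickening (η n) (t n), fun n => Metric.ediam (t n) + 2 * η n,
    fun n => Metric.isOpen_thickening, ?_, ?_, ?_, fun n => Metric.ediam_thickening_le _, ?_⟩
  · exact hcov.trans (iUnion_mono fun n => Metric.self_subset_thickening (by simpa using hη0 n) _)
  · intro n
    simp [(hη0 n).ne']
  · intro n
    simp [hfin n, ENNReal.mul_eq_top]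
  · calc ∑' n, (Metric.ediam (t n) + 2 * (η n : ℝ≥0∞)) ^ s
        ≤ ∑' n, (Metric.ediam (t n) ^ s + e n) := ENNReal.tsum_le_tsum fun n => (hη n).le
      _ = ∑' n, Metric.ediam (t n) ^ s + ∑' n, (e n : ℝ≥0∞) := ENNReal.tsum_add
      _ < ε / 2 + ε / 2 := ENNReal.add_lt_add hsum hesum
      _ = ε := ENNReal.add_halves ε

/-- A decreasing intersection of compact sets that carry measures with mass bounded below and
bounded `s`-energy is nonempty with dimension at least `s`. -/
theorem le_dimH_iInter_of_rieszEnergy_le [BorelSpace Y] {s : ℝ≥0}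
    {K : ℕ → Set Y} (hK : ∀ n, IsCompact (K n)) (hanti : Antitone K) (m : ℕ → Measure Y)
    [∀ n, IsFiniteMeasure (m n)] (hsupp : ∀ n, m n (K n)ᶜ = 0) {a C : ℝ≥0∞} (ha : a ≠ 0)
    (hC : C ≠ ∞) (h : ∃ᶠ n in atTop, a ≤ m n univ ∧ rieszEnergy s (m n) ≤ C) :
    (⋂ n, K n).Nonempty ∧ (s : ℝ≥0∞) ≤ dimH (⋂ n, K n) := by
  have hle : ∀ n, m n univ ≤ m n (K n) := fun n => by
    calc m n univ ≤ m n (K n) + m n (K n)ᶜ := by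
          rw [← union_compl_self (K n)]; exact measure_union_le _ _
      _ = m n (K n) := by rw [hsupp, add_zero]
  refine ⟨IsCompact.nonempty_iInter_of_sequence_nonempty_isCompact_isClosed K
    (fun i => hanti i.le_succ) (fun i => ?_) (hK 0) fun i => (hK i).isClosed, ?_⟩
  · obtain ⟨n, hn, h1, -⟩ := (frequently_atTop.1 h) i
    refine (nonempty_of_measure_ne_zero (μ := m n) ?_).mono (hanti hn)
    exact ((pos_iff_ne_zero.2 ha).trans_le (h1.trans (hle n))).ne'
  by_contra! hlt
  have hs : (0 : ℝ) < s := by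
    rcases eq_or_lt_of_le (bot_le : 0 ≤ s) with h0 | h0
    · simp [← h0] at hlt
    · exact_mod_cast h0
  have h0 := hausdorffMeasure_of_dimH_lt hlt
  obtain ⟨n₀, -, ha', -⟩ := (frequently_atTop.1 h) 0
  have hatop : a ≠ ∞ := (ha'.trans_lt (measure_lt_top _ _)).ne
  -- the parameter `l` makes the energy term less than `a / 2`
  obtain ⟨l, hl0, hl, hlC⟩ : ∃ l : ℝ≥0∞, l ≠ 0 ∧ l ≠ ∞ ∧ l⁻¹ * C < a / 2 := by
    have hpos : a / 2 ≠ 0 := (ENNReal.half_pos ha).ne'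
    have ht : Tendsto (fun x : ℝ≥0∞ => x * C) (nhdsWithin 0 (Ioi 0)) (nhds (0 * C)) :=
      ((ENNReal.continuous_mul_const hC).tendsto 0).mono_left nhdsWithin_le_nhds
    rw [zero_mul] at ht
    have hev := ht.eventually (Iio_mem_nhds (pos_iff_ne_zero.2 hpos))
    have hev1 : ∀ᶠ x : ℝ≥0∞ in nhdsWithin 0 (Ioi 0), x < 1 :=
      nhdsWithin_le_nhds (Iio_mem_nhds one_pos)
    have : (nhdsWithin (0 : ℝ≥0∞) (Ioi 0)).NeBot := inferInstance
    obtain ⟨x, ⟨h1, h2⟩, h3⟩ := ((hev.and self_mem_nhdsWithin).and hev1).exists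
    refine ⟨x⁻¹, ?_, ?_, ?_⟩
    · simpa using (h3.trans ENNReal.one_lt_top).ne
    · simpa using (ne_of_gt h2)
    · simpa using h1
  obtain ⟨U, d, hUo, hcov, hd0, hd, hdiam, hsum⟩ :=
    exists_open_cover_of_hausdorffMeasure_eq_zero hs h0 (ε := l⁻¹ * (a / 2))
      (mul_ne_zero (by simpa using hl) (ENNReal.half_pos ha).ne')
  -- Compactness places a whole `K i` inside the open cover, so the approximating measures are
  -- tested directly and no limit measure is needed.
  obtain ⟨i, hi⟩ := exists_subset_nhds_of_isCompact (V := K) (U := ⋃ n, U n)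
    (directed_of_isDirected_le fun _ _ h => hanti h) hK
    fun x hx => (isOpen_iUnion hUo).mem_nhds (hcov hx)
  obtain ⟨n, hn, h1, h2⟩ := (frequently_atTop.1 h) i
  have : a < a := calc
    a ≤ m n (K n) := h1.trans (hle n)
    _ ≤ m n (⋃ n, U n) := measure_mono ((hanti hn).trans hi)
    _ ≤ l * ∑' n, d n ^ (s : ℝ) + l⁻¹ * rieszEnergy s (m n) :=
        measure_iUnion_le_of_ediam_le (m n) hs (fun n => (hUo n).measurableSet) hd0 hd hdiam hl0 hl
    _ ≤ l * (l⁻¹ * (a / 2)) + l⁻¹ * C := by gcongr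
    _ < a / 2 + a / 2 := by
        rw [← mul_assoc, ENNReal.mul_inv_cancel hl0 hl, one_mul]
        exact ENNReal.add_lt_add_left (ENNReal.div_ne_top hatop (by simp)) hlC
    _ = a := ENNReal.add_halves a
  exact lt_irrefl _ this

end Energy

/-! ### Counting consequences of divergence. -/

theorem rpow_half_pow_lt_one {p : ℝ} (hp : 0 < p) : ((1 / 2 : ℝ)) ^ p < 1 :=
  Real.rpow_lt_one (by norm_num) (by norm_num) hp

theorem half_pow_rpow (p : ℝ) (j : ℕ) : ((1 / 2 : ℝ) ^ j) ^ p = ((1 / 2 : ℝ) ^ p) ^ j :=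
  (Real.rpow_pow_comm (by norm_num) p j).symm

/-- Dyadic grouping: at most `C * 2 ^ ((j + 1) * a)` terms lie in `(2 ^ (-(j + 1)), 2 ^ (-j)]`, so
the groups are dominated by a geometric series of ratio `2 ^ (-(b - a))`. -/
theorem summable_rpow_of_card_le {r : ℕ → ℝ} (hr : ∀ n, 0 < r n ∧ r n ≤ 1) {a b C : ℝ}
    (ha : 0 ≤ a) (hab : a < b)
    (h : ∀ t : ℝ, 0 < t → t ≤ 1 → ∀ S : Finset ℕ, (∀ n ∈ S, t ≤ r n) →
      (S.card : ℝ) ≤ C * t ^ (-a)) :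
    Summable fun n => r n ^ b := by
  have hb : 0 ≤ b := ha.trans hab.le
  have hj : ∀ n, ∃ j : ℕ, (1 / 2 : ℝ) ^ (j + 1) < r n ∧ r n ≤ (1 / 2 : ℝ) ^ j := fun n =>
    exists_nat_pow_near_of_lt_one (hr n).1 (hr n).2 (by norm_num) (by norm_num)
  choose j hj1 hj2 using hj
  have hC : 0 ≤ C := by
    have := h 1 one_pos le_rfl ∅ (by simp)
    simpa using this
  set q : ℝ := (1 / 2 : ℝ) ^ (b - a) with hq
  have hq0 : 0 ≤ q := by positivity
  have hq1 : q < 1 := rpow_half_pow_lt_one (sub_pos.2 hab)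
  have hsum := summable_geometric_of_lt_one hq0 hq1
  refine summable_of_sum_le (c := C * (2 : ℝ) ^ a * ∑' i : ℕ, q ^ i)
    (fun n => Real.rpow_nonneg (hr n).1.le b) fun F => ?_
  rw [← Finset.sum_fiberwise_of_maps_to (t := F.image j) (g := j)
    fun i hi => Finset.mem_image_of_mem j hi]
  calc ∑ i ∈ F.image j, ∑ n ∈ F with j n = i, r n ^ b
      ≤ ∑ i ∈ F.image j, C * (2 : ℝ) ^ a * q ^ i := by
        refine Finset.sum_le_sum fun i _ => ?_
        calc ∑ n ∈ F with j n = i, r n ^ b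
            ≤ ∑ n ∈ F with j n = i, ((1 / 2 : ℝ) ^ i) ^ b := by
              refine Finset.sum_le_sum fun n hn => ?_
              obtain ⟨-, rfl⟩ := Finset.mem_filter.1 hn
              exact Real.rpow_le_rpow (hr n).1.le (hj2 n) hb
          _ = ({n ∈ F | j n = i}.card : ℝ) * ((1 / 2 : ℝ) ^ i) ^ b := by
              rw [Finset.sum_const, nsmul_eq_mul]
          _ ≤ (C * ((1 / 2 : ℝ) ^ (i + 1)) ^ (-a)) * ((1 / 2 : ℝ) ^ i) ^ b := by
              gcongr
              refine h _ (by positivity) (pow_le_one₀ (by norm_num) (by norm_num)) _ fun n hn => ?_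
              obtain ⟨-, rfl⟩ := Finset.mem_filter.1 hn
              exact (hj1 n).le
          _ = C * (2 : ℝ) ^ a * q ^ i := by
              have h1 : ((1 / 2 : ℝ) ^ (i + 1)) ^ (-a) = ((1 / 2 : ℝ) ^ i) ^ (-a) * 2 ^ a := by
                rw [pow_succ, Real.mul_rpow (by positivity) (by norm_num)]
                congr 1
                rw [Real.rpow_neg (by norm_num), ← Real.inv_rpow (by norm_num)]
                norm_num
              have h2 : q ^ i = ((1 / 2 : ℝ) ^ i) ^ b * ((1 / 2 : ℝ) ^ i) ^ (-a) := by
                rw [← Real.rpow_add (by positivity), half_pow_rpow, ← sub_eq_add_neg]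
              rw [h1, h2]; ring
    _ = C * (2 : ℝ) ^ a * ∑ i ∈ F.image j, q ^ i := by rw [Finset.mul_sum]
    _ ≤ C * (2 : ℝ) ^ a * ∑' i : ℕ, q ^ i := by
        gcongr
        exact hsum.sum_le_tsum _ fun i _ => pow_nonneg hq0 i

/-- If `∑ r n ^ b` diverges, then for every `a < b` there are arbitrarily small thresholds `t`
exceeded by at least `t ^ (-a)` terms with large index. -/
theorem exists_card_ge_of_not_summable {r : ℕ → ℝ} (hr : ∀ n, 0 < r n ∧ r n ≤ 1) {a b : ℝ}
    (ha : 0 ≤ a) (hab : a < b) (hdiv : ¬ Summable fun n => r n ^ b) (n₀ : ℕ) {t₀ : ℝ}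
    (ht₀ : 0 < t₀) (ht₁ : t₀ ≤ 1) :
    ∃ t : ℝ, 0 < t ∧ t < t₀ ∧ ∃ S : Finset ℕ, (∀ n ∈ S, n₀ ≤ n ∧ t ≤ r n) ∧
      t ^ (-a) ≤ S.card := by
  by_contra! hcon
  -- The constant `(t₀ / 2) ^ (-a)` absorbs the thresholds `t ≥ t₀`, whose counts are bounded by the
  -- count at `t₀ / 2`.
  refine hdiv ((summable_nat_add_iff n₀).1 (summable_rpow_of_card_le (fun n => hr (n + n₀)) ha hab
    (C := (t₀ / 2) ^ (-a)) fun t ht ht' S hS => ?_))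
  have hmap : (S.map (addRightEmbedding n₀)).card = S.card := Finset.card_map _
  have h1 : (1 : ℝ) ≤ t ^ (-a) :=
    Real.one_le_rpow_of_pos_of_le_one_of_nonpos ht ht' (by linarith)
  have h2 : (1 : ℝ) ≤ (t₀ / 2) ^ (-a) :=
    Real.one_le_rpow_of_pos_of_le_one_of_nonpos (by linarith) (by linarith) (by linarith)
  rcases lt_or_ge t t₀ with h | h
  · have := hcon t ht h (S.map (addRightEmbedding n₀)) (by
      intro n hn
      obtain ⟨m, hm, rfl⟩ := Finset.mem_map.1 hn
      exact ⟨by simp, hS m hm⟩)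
    rw [hmap] at this
    nlinarith
  · have := hcon (t₀ / 2) (by linarith) (by linarith) (S.map (addRightEmbedding n₀)) (by
      intro n hn
      obtain ⟨m, hm, rfl⟩ := Finset.mem_map.1 hn
      have hm' := hS m hm
      change n₀ ≤ m + n₀ ∧ t₀ / 2 ≤ r (m + n₀)
      exact ⟨by simp, by linarith⟩)
    rw [hmap] at this
    nlinarith

theorem exists_sum_ge_of_not_summable {f : ℕ → ℝ} (hf : ∀ n, 0 ≤ f n) (h : ¬ Summable f) (n₀ : ℕ)
    (L : ℝ) : ∃ S : Finset ℕ, (∀ n ∈ S, n₀ ≤ n) ∧ L ≤ ∑ n ∈ S, f n := by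
  by_contra! hcon
  refine h ((summable_nat_add_iff n₀).1 (summable_of_sum_le (c := L) (fun n => hf _) fun F => ?_))
  have := hcon (F.map (addRightEmbedding n₀)) (by
    intro n hn
    obtain ⟨m, -, rfl⟩ := Finset.mem_map.1 hn
    simp)
  rw [Finset.sum_map] at this
  exact this.le

/-! ### Ahlfors regular measures: neighbourhoods and local energies. -/

section Ahlfors

theorem IsAhlforsRegular.exists_measure {G : Set UnitAddCircle} {γ : ℝ}
    (hG : IsAhlforsRegular G γ) (hne : G.Nonempty) :
    ∃ μ : Measure UnitAddCircle, IsFiniteMeasure μ ∧ μ Gᶜ = 0 ∧ μ univ ≠ 0 ∧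
      ∃ c : ℝ≥0∞, c ≠ ∞ ∧
        (∀ x ∈ G, ∀ t : ℝ, 0 < t → t ≤ 1 / 2 →
          ENNReal.ofReal (t ^ γ) ≤ c * μ (Metric.ball x t)) ∧
        ∀ x ∈ G, ∀ t : ℝ, 0 < t → μ (Metric.closedBall x t) ≤ c * ENNReal.ofReal (t ^ γ) := by
  obtain ⟨c, hc, h⟩ := hG.exists_const
  have hγ := hG.dim_pos
  have happ : ∀ x t, (Measure.hausdorffMeasure γ).restrict G (Metric.ball x t) =
      Measure.hausdorffMeasure γ (G ∩ Metric.ball x t) := fun x t => by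
    rw [Measure.restrict_apply Metric.isOpen_ball.measurableSet, inter_comm]
  set μ : Measure UnitAddCircle := (Measure.hausdorffMeasure γ).restrict G with hμ
  have hfin : Measure.hausdorffMeasure γ G < ∞ := by
    obtain ⟨F, hFG, hF⟩ := hG.isCompact.elim_nhds_subcover (fun x => Metric.ball x (1 / 2))
      (fun x _ => Metric.ball_mem_nhds x (by norm_num))
    calc Measure.hausdorffMeasure γ G
        ≤ Measure.hausdorffMeasure γ (⋃ x ∈ F, G ∩ Metric.ball x (1 / 2)) := by
          refine measure_mono fun y hy => ?_
          obtain ⟨x, hx, hyx⟩ := mem_iUnion₂.1 (hF hy)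
          exact mem_iUnion₂.2 ⟨x, hx, hy, hyx⟩
      _ ≤ ∑ x ∈ F, Measure.hausdorffMeasure γ (G ∩ Metric.ball x (1 / 2)) :=
          measure_biUnion_finset_le _ _
      _ < ∞ := by
          refine ENNReal.sum_lt_top.2 fun x hx => ?_
          exact (h x (hFG x hx) (1 / 2) (by norm_num) le_rfl).2.trans_lt ENNReal.ofReal_lt_top
  have hμfin : IsFiniteMeasure μ := ⟨by rw [hμ, Measure.restrict_apply_univ]; exact hfin⟩
  have hball : ∀ x ∈ G, ∀ t : ℝ, 0 < t → t ≤ 1 / 2 →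
      ENNReal.ofReal (t ^ γ) ≤ ENNReal.ofReal c * μ (Metric.ball x t) := by
    intro x hx t ht ht'
    rw [happ]
    calc ENNReal.ofReal (t ^ γ) = ENNReal.ofReal c * ENNReal.ofReal (t ^ γ / c) := by
          rw [← ENNReal.ofReal_mul hc.le, mul_div_cancel₀ _ hc.ne']
      _ ≤ _ := by gcongr; exact (h x hx t ht ht').1
  -- The three summands serve the lower bound, the upper bound for `t ≤ 1 / 4` (a closed ball lies
  -- in the open ball of radius `2 * t ≤ 1 / 2`), and the trivial upper bound for `t > 1 / 4`.
  refine ⟨μ, hμfin, ?_, ?_, ENNReal.ofReal c + ENNReal.ofReal (c * 2 ^ γ) +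
    μ univ * ENNReal.ofReal (4 ^ γ), ?_, ?_, ?_⟩
  · rw [hμ, Measure.restrict_apply hG.isCompact.isClosed.measurableSet.compl]
    simp
  · obtain ⟨x, hx⟩ := hne
    have h1 := hball x hx (1 / 2) (by norm_num) le_rfl
    intro h0
    rw [measure_mono_null (subset_univ _) h0, mul_zero, nonpos_iff_eq_zero,
      ENNReal.ofReal_eq_zero] at h1
    exact absurd h1 (not_le.2 (by positivity))
  · exact ENNReal.add_ne_top.2 ⟨by simp, ENNReal.mul_ne_top (measure_ne_top _ _) (by simp)⟩
  · intro x hx t ht ht'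
    refine (hball x hx t ht ht').trans ?_
    gcongr
    rw [add_assoc]
    exact le_self_add
  · intro x hx t ht
    rcases le_or_gt t (1 / 4) with h4 | h4
    · calc μ (Metric.closedBall x t) ≤ μ (Metric.ball x (2 * t)) :=
            measure_mono (Metric.closedBall_subset_ball (by linarith))
        _ ≤ ENNReal.ofReal (c * (2 * t) ^ γ) := by
            rw [happ]; exact (h x hx (2 * t) (by linarith) (by linarith)).2
        _ = ENNReal.ofReal (c * 2 ^ γ) * ENNReal.ofReal (t ^ γ) := by
            rw [← ENNReal.ofReal_mul (by positivity), Real.mul_rpow (by norm_num) ht.le, mul_assoc]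
        _ ≤ _ := by
            gcongr
            exact le_add_self.trans le_self_add
    · calc μ (Metric.closedBall x t) ≤ μ univ * 1 := by
            rw [mul_one]; exact measure_mono (subset_univ _)
        _ ≤ μ univ * (ENNReal.ofReal (4 ^ γ) * ENNReal.ofReal (t ^ γ)) := by
            gcongr
            rw [← ENNReal.ofReal_mul (by positivity), ← Real.mul_rpow (by norm_num) ht.le,
              ENNReal.one_le_ofReal]
            exact Real.one_le_rpow (by linarith) hγ.le
        _ ≤ _ := by
            rw [← mul_assoc]
            gcongr
            exact le_add_self

theorem volume_unitAddCircle_closedBall_le (x : UnitAddCircle) (t : ℝ) :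
    volume (Metric.closedBall x t) ≤ ENNReal.ofReal (2 * t) := by
  rw [AddCircle.volume_closedBall]
  exact ENNReal.ofReal_le_ofReal (min_le_right _ _)

theorem volume_unitAddCircle_closedBall {t : ℝ} (ht : t ≤ 1 / 2) (x : UnitAddCircle) :
    volume (Metric.closedBall x t) = ENNReal.ofReal (2 * t) := by
  rw [AddCircle.volume_closedBall, min_eq_right (by linarith)]

/-- A point within `t` of `G` is the center of a ball of radius `2 * t` with `μ`-mass at least `t ^
γ / c`. By Fubini these masses integrate to at most `4 * t * μ univ`, and Markov's inequality
concludes. -/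
theorem volume_thickening_le {G : Set UnitAddCircle} {γ : ℝ} (μ : Measure UnitAddCircle)
    [IsFiniteMeasure μ] {c : ℝ≥0∞} (hμ : ∀ x ∈ G, ∀ t : ℝ, 0 < t → t ≤ 1 / 2 →
      ENNReal.ofReal (t ^ γ) ≤ c * μ (Metric.ball x t)) {t : ℝ} (ht : 0 < t) (ht' : t ≤ 1 / 2) :
    volume (Metric.thickening t G) ≤ 4 * c * μ univ * ENNReal.ofReal (t ^ (1 - γ)) := by
  have hmeas : MeasurableSet {p : UnitAddCircle × UnitAddCircle | dist p.1 p.2 ≤ 2 * t} :=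
    (isClosed_le (by fun_prop) continuous_const).measurableSet
  have hm1 : Measurable fun x : UnitAddCircle => μ (Metric.closedBall x (2 * t)) := by
    convert measurable_measure_prodMk_left (ν := μ) hmeas using 3 with x
    ext y; simp [dist_comm]
  have key : ENNReal.ofReal (t ^ γ) * volume (Metric.thickening t G) ≤
      c * (ENNReal.ofReal (4 * t) * μ univ) := by
    calc ENNReal.ofReal (t ^ γ) * volume (Metric.thickening t G)
        ≤ ENNReal.ofReal (t ^ γ) * volume {x : UnitAddCircle | ENNReal.ofReal (t ^ γ) ≤
            c * μ (Metric.closedBall x (2 * t))} := by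
          gcongr
          intro x hx
          obtain ⟨y, hy, hxy⟩ := Metric.mem_thickening_iff.1 hx
          refine (hμ y hy t ht ht').trans ?_
          gcongr
          intro z hz
          rw [Metric.mem_ball] at hz
          rw [Metric.mem_closedBall]
          linarith [dist_triangle z y x, dist_comm x y]
      _ ≤ ∫⁻ x : UnitAddCircle, c * μ (Metric.closedBall x (2 * t)) :=
          mul_meas_ge_le_lintegral (hm1.const_mul c) _
      _ = c * ∫⁻ x : UnitAddCircle, μ (Metric.closedBall x (2 * t)) := lintegral_const_mul _ hm1
      _ = c * ∫⁻ y, volume (Metric.closedBall y (2 * t)) ∂μ := by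
          congr 1
          have h1 := Measure.prod_apply (μ := (volume : Measure UnitAddCircle)) (ν := μ) hmeas
          have h2 := Measure.prod_apply_symm (μ := (volume : Measure UnitAddCircle)) (ν := μ) hmeas
          rw [h1] at h2
          convert h2 using 4 with x
          · ext y; simp [dist_comm]
          · rfl
      _ ≤ c * ∫⁻ _, ENNReal.ofReal (4 * t) ∂μ := by
          gcongr with y
          refine (volume_unitAddCircle_closedBall_le y _).trans_eq ?_
          ring_nf
      _ = c * (ENNReal.ofReal (4 * t) * μ univ) := by rw [lintegral_const]
  have hpos : ENNReal.ofReal (t ^ γ) ≠ 0 := by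
    rw [Ne, ENNReal.ofReal_eq_zero, not_le]; positivity
  refine (ENNReal.mul_le_mul_iff_right hpos ENNReal.ofReal_ne_top).1 (key.trans_eq ?_)
  have h4 : ENNReal.ofReal (4 * t) =
      4 * (ENNReal.ofReal (t ^ γ) * ENNReal.ofReal (t ^ (1 - γ))) := by
    rw [← ENNReal.ofReal_mul (by positivity), ← Real.rpow_add ht, ENNReal.ofReal_mul (by norm_num)]
    simp
  rw [h4]; ring

/-- On the dyadic annulus of radius about `u * 2 ^ (-j)` the kernel times the mass is `O((u * 2 ^
(-j)) ^ (γ - s))`, a geometric series because `s < γ`. -/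
theorem lintegral_edist_rpow_neg_le {Y : Type*} [MetricSpace Y] [MeasurableSpace Y] [BorelSpace Y]
    {G : Set Y} {γ s : ℝ} (hs : 0 ≤ s) (hsγ : s < γ) (μ : Measure Y) {c : ℝ≥0∞} (hc : c ≠ ∞)
    (hμ : ∀ x ∈ G, ∀ t : ℝ, 0 < t → μ (Metric.closedBall x t) ≤ c * ENNReal.ofReal (t ^ γ)) :
    ∃ C : ℝ≥0∞, C ≠ ∞ ∧ ∀ x ∈ G, ∀ u : ℝ, 0 < u →
      ∫⁻ y in Metric.closedBall x u, edist x y ^ (-s) ∂μ ≤ C * ENNReal.ofReal (u ^ (γ - s)) := by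
  have hγ : 0 < γ := hs.trans_lt hsγ
  set q : ℝ := (1 / 2 : ℝ) ^ (γ - s) with hq
  have hq0 : 0 ≤ q := by positivity
  have hq1 : q < 1 := rpow_half_pow_lt_one (sub_pos.2 hsγ)
  refine ⟨c * ENNReal.ofReal (2 ^ s) * ∑' j : ℕ, ENNReal.ofReal (q ^ j), ?_, ?_⟩
  · refine ENNReal.mul_ne_top (ENNReal.mul_ne_top hc (by simp)) ?_
    exact (summable_geometric_of_lt_one hq0 hq1).tsum_ofReal_ne_top
  intro x hx u hu
  -- The annuli miss the center, where the kernel is infinite if `s > 0`.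
  have hnull : μ {x} = 0 := by
    have ht : Tendsto (fun t : ℝ => c * ENNReal.ofReal (t ^ γ)) (nhdsWithin 0 (Ioi 0))
        (nhds 0) := by
      have h1 : ContinuousAt (fun t : ℝ => t ^ γ) 0 :=
        Real.continuousAt_rpow_const _ _ (Or.inr hγ.le)
      have h2 := (ENNReal.continuous_const_mul hc).continuousAt.comp
        (ENNReal.continuous_ofReal.continuousAt.comp h1)
      have h3 := h2.tendsto.mono_left (nhdsWithin_le_nhds (s := Ioi (0 : ℝ)))
      simpa [Function.comp_def, Real.zero_rpow hγ.ne'] using h3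
    refine le_antisymm (ge_of_tendsto ht ?_) bot_le
    filter_upwards [self_mem_nhdsWithin] with t ht
    refine (measure_mono ?_).trans (hμ x hx t ht)
    simpa using (le_of_lt ht : (0 : ℝ) ≤ t)
  have hpt : ∀ᵐ y ∂μ.restrict (Metric.closedBall x u), edist x y ^ (-s) ≤
      ∑' j : ℕ, (Metric.closedBall x (u * (1 / 2) ^ j)).indicator
        (fun _ => ENNReal.ofReal ((u * (1 / 2) ^ (j + 1)) ^ (-s))) y := by
    have hne : ∀ᵐ y ∂μ.restrict (Metric.closedBall x u), y ≠ x := by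
      refine ae_restrict_of_ae ?_
      rw [ae_iff]
      simpa using hnull
    filter_upwards [hne, ae_restrict_mem Metric.isClosed_closedBall.measurableSet] with y hy hyu
    have hd : 0 < dist x y := dist_pos.2 (Ne.symm hy)
    rw [Metric.mem_closedBall, dist_comm] at hyu
    obtain ⟨j, hj1, hj2⟩ := exists_nat_pow_near_of_lt_one (x := dist x y / u) (y := (1 / 2 : ℝ))
      (by positivity) ((div_le_one hu).2 hyu) (by norm_num) (by norm_num)
    rw [lt_div_iff₀ hu] at hj1
    rw [div_le_iff₀ hu] at hj2
    refine le_trans ?_ (ENNReal.le_tsum j)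
    rw [indicator_of_mem (by rw [Metric.mem_closedBall, dist_comm]; linarith), edist_dist,
      ENNReal.ofReal_rpow_of_pos hd]
    refine ENNReal.ofReal_le_ofReal ?_
    exact Real.rpow_le_rpow_of_nonpos (by positivity) (by linarith) (by linarith)
  calc ∫⁻ y in Metric.closedBall x u, edist x y ^ (-s) ∂μ
      ≤ ∫⁻ y in Metric.closedBall x u, ∑' j : ℕ, (Metric.closedBall x (u * (1 / 2) ^ j)).indicator
        (fun _ => ENNReal.ofReal ((u * (1 / 2) ^ (j + 1)) ^ (-s))) y ∂μ := lintegral_mono_ae hpt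
    _ ≤ ∫⁻ y, ∑' j : ℕ, (Metric.closedBall x (u * (1 / 2) ^ j)).indicator
        (fun _ => ENNReal.ofReal ((u * (1 / 2) ^ (j + 1)) ^ (-s))) y ∂μ :=
        setLIntegral_le_lintegral _ _
    _ = ∑' j : ℕ, ENNReal.ofReal ((u * (1 / 2) ^ (j + 1)) ^ (-s)) *
          μ (Metric.closedBall x (u * (1 / 2) ^ j)) := by
        rw [lintegral_tsum fun j => (measurable_const.indicator
          Metric.isClosed_closedBall.measurableSet).aemeasurable]
        congr 1; ext j
        rw [lintegral_indicator_const Metric.isClosed_closedBall.measurableSet]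
    _ ≤ ∑' j : ℕ, ENNReal.ofReal ((u * (1 / 2) ^ (j + 1)) ^ (-s)) *
          (c * ENNReal.ofReal ((u * (1 / 2) ^ j) ^ γ)) := by
        gcongr with j
        exact hμ x hx _ (by positivity)
    _ = ∑' j : ℕ, c * ENNReal.ofReal (2 ^ s) * ENNReal.ofReal (u ^ (γ - s)) *
          ENNReal.ofReal (q ^ j) := by
        congr 1; ext j
        have h1 : (u * (1 / 2 : ℝ) ^ (j + 1)) ^ (-s) * (u * (1 / 2) ^ j) ^ γ =
            2 ^ s * u ^ (γ - s) * q ^ j := by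
          have e1 : (u * (1 / 2 : ℝ) ^ (j + 1)) ^ (-s) = (u * (1 / 2) ^ j) ^ (-s) * 2 ^ s := by
            rw [pow_succ, ← mul_assoc, Real.mul_rpow (by positivity) (by norm_num)]
            congr 1
            rw [Real.rpow_neg (by norm_num), ← Real.inv_rpow (by norm_num)]
            norm_num
          rw [e1, mul_right_comm, ← Real.rpow_add (by positivity),
            Real.mul_rpow hu.le (by positivity), half_pow_rpow, show -s + γ = γ - s by ring]
          ring
        calc ENNReal.ofReal ((u * (1 / 2 : ℝ) ^ (j + 1)) ^ (-s)) *
              (c * ENNReal.ofReal ((u * (1 / 2) ^ j) ^ γ))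
            = c * ENNReal.ofReal ((u * (1 / 2 : ℝ) ^ (j + 1)) ^ (-s) * (u * (1 / 2) ^ j) ^ γ) := by
              rw [ENNReal.ofReal_mul (by positivity)]; ring
          _ = _ := by
              rw [h1, ENNReal.ofReal_mul (by positivity), ENNReal.ofReal_mul (by positivity)]; ring
    _ = _ := by rw [ENNReal.tsum_mul_left]; ring

end Ahlfors

/-! ### Passing between the exponent and limsup sets. -/

section Exponent

theorem mem_limsupSet_rpow_of_lt {x : ℕ → UnitAddCircle} {r : ℕ → ℝ}
    (hr : ∀ n, 0 < r n ∧ r n ≤ 1) {ξ : UnitAddCircle} {ν : ℝ}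
    (h : ENNReal.ofReal ν < approxExponent x r ξ) : ξ ∈ limsupSet x fun n => r n ^ ν := by
  rw [approxExponent, lt_iSup_iff] at h
  obtain ⟨κ, h⟩ := h
  obtain ⟨hmem, h⟩ := lt_iSup_iff.1 h
  have hle : ν ≤ κ := by
    by_contra! hlt
    refine absurd h (not_lt.2 ?_)
    rw [← ENNReal.ofReal_coe_nnreal]
    exact ENNReal.ofReal_le_ofReal hlt.le
  refine Frequently.mono hmem fun n hn => lt_of_lt_of_le hn ?_
  exact Real.rpow_le_rpow_of_exponent_ge (hr n).1 (hr n).2 hle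

theorem ofReal_le_approxExponent {x : ℕ → UnitAddCircle} {r : ℕ → ℝ} {ξ : UnitAddCircle} {ν : ℝ}
    (h : ∀ κ : ℝ, 0 ≤ κ → κ < ν → ξ ∈ limsupSet x fun n => r n ^ κ) :
    ENNReal.ofReal ν ≤ approxExponent x r ξ := by
  refine le_of_forall_lt fun b hb => ?_
  obtain ⟨κ, hbκ, hκ⟩ := ENNReal.lt_iff_exists_nnreal_btwn.1 hb
  have hκν : (κ : ℝ) < ν := by
    rw [← ENNReal.ofReal_coe_nnreal] at hκ
    exact (ENNReal.ofReal_lt_ofReal_iff_of_nonneg κ.2).1 hκ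
  exact hbκ.trans_le (le_iSup₂_of_le κ (h κ κ.2 hκν) le_rfl)

end Exponent

/-! ### Almost sure covering, first moments and upper bounds. -/

section Covering

variable {Ω : Type*} [MeasurableSpace Ω] {P : Measure Ω}
  {X : ℕ → Ω → UnitAddCircle}

/-- If `ξ` is at distance at least `t` from all the points, then every `η` within `t / 4` of `ξ` is
at distance more than `t / 2` from them. Thus an uncovered point forces a set of such `η` of length
`t / 2`, while each fixed `η` has this property with probability at most `exp (-t)` per index;
Fubini and Markov compare the two. -/
theorem measure_exists_uncovered_le (hX : ∀ n, Measurable (X n))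
    (hunif : ∀ n, P.map (X n) = (volume : Measure UnitAddCircle)) (hindep : iIndepFun X P)
    {t : ℝ} (ht : 0 < t) (ht' : t ≤ 1) (S : Finset ℕ) :
    P {ω | ∃ ξ, ∀ n ∈ S, t ≤ dist ξ (X n ω)} ≤
      ENNReal.ofReal (2 / t * Real.exp (-(S.card * t))) := by
  have := hindep.isProbabilityMeasure
  set U : Set (Ω × UnitAddCircle) := {p | ∀ n ∈ S, X n p.1 ∈ (Metric.closedBall p.2 (t / 2))ᶜ}
    with hU
  have hUm : MeasurableSet U := by
    have : U = ⋂ n ∈ S, {p : Ω × UnitAddCircle | t / 2 < dist (X n p.1) p.2} := by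
      ext p; simp [hU]
    rw [this]
    refine Finset.measurableSet_biInter S fun n _ => ?_
    exact measurableSet_lt measurable_const
      (((hX n).comp measurable_fst).dist measurable_snd)
  have hslice : ∀ η, P ((fun ω => (ω, η)) ⁻¹' U) ≤ ENNReal.ofReal (Real.exp (-(S.card * t))) := by
    intro η
    have h1 : (fun ω => (ω, η)) ⁻¹' U =
        ⋂ n ∈ S, X n ⁻¹' (Metric.closedBall η (t / 2))ᶜ := by
      ext ω; simp [hU]
    rw [h1, hindep.measure_inter_preimage_eq_mul S fun n _ =>
      Metric.isClosed_closedBall.measurableSet.compl]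
    have h2 : ∀ n ∈ S, P (X n ⁻¹' (Metric.closedBall η (t / 2))ᶜ) ≤
        ENNReal.ofReal (Real.exp (-t)) := by
      intro n _
      rw [← Measure.map_apply (hX n) Metric.isClosed_closedBall.measurableSet.compl, hunif,
        measure_compl Metric.isClosed_closedBall.measurableSet (measure_ne_top _ _),
        UnitAddCircle.measure_univ, volume_unitAddCircle_closedBall (by linarith),
        ← ENNReal.ofReal_one, ← ENNReal.ofReal_sub _ (by linarith)]
      refine ENNReal.ofReal_le_ofReal ?_
      linarith [Real.add_one_le_exp (-t)]
    refine (Finset.prod_le_pow_card S _ _ h2).trans_eq ?_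
    rw [← ENNReal.ofReal_pow (Real.exp_pos _).le, ← Real.exp_nat_mul, mul_neg]
  have hmain : ENNReal.ofReal (t / 2) * P {ω | ∃ ξ, ∀ n ∈ S, t ≤ dist ξ (X n ω)} ≤
      ENNReal.ofReal (Real.exp (-(S.card * t))) := by
    calc ENNReal.ofReal (t / 2) * P {ω | ∃ ξ, ∀ n ∈ S, t ≤ dist ξ (X n ω)}
        ≤ ENNReal.ofReal (t / 2) *
            P {ω | ENNReal.ofReal (t / 2) ≤
              (volume : Measure UnitAddCircle) (Prod.mk ω ⁻¹' U)} := by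
          gcongr with ω
          rintro ⟨ξ, hξ⟩
          calc ENNReal.ofReal (t / 2) = volume (Metric.closedBall ξ (t / 4)) := by
                rw [volume_unitAddCircle_closedBall (by linarith)]; ring_nf
            _ ≤ _ := by
                refine measure_mono fun η hη n hn => ?_
                rw [Metric.mem_closedBall] at hη
                simp only [mem_compl_iff, Metric.mem_closedBall, not_le]
                linarith [hξ n hn, dist_triangle ξ η (X n ω), dist_comm ξ η, dist_comm η (X n ω)]
      _ ≤ ∫⁻ ω, volume (Prod.mk ω ⁻¹' U) ∂P :=
          mul_meas_ge_le_lintegral (measurable_measure_prodMk_left hUm) _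
      _ = ∫⁻ η, P ((fun ω => (ω, η)) ⁻¹' U) := by
          rw [← Measure.prod_apply hUm, Measure.prod_apply_symm hUm]
      _ ≤ ∫⁻ _ : UnitAddCircle, ENNReal.ofReal (Real.exp (-(S.card * t))) :=
          lintegral_mono hslice
      _ = _ := by rw [lintegral_const, UnitAddCircle.measure_univ, mul_one]
  have hpos : ENNReal.ofReal (t / 2) ≠ 0 := by
    rw [Ne, ENNReal.ofReal_eq_zero, not_le]; positivity
  refine (ENNReal.mul_le_mul_iff_right hpos ENNReal.ofReal_ne_top).1 (hmain.trans_eq ?_)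
  rw [← ENNReal.ofReal_mul (by positivity)]
  congr 1
  field_simp

theorem tendsto_rpow_neg_mul_exp_neg_rpow_neg {ν κ : ℝ} (hκ : 0 < κ) :
    Tendsto (fun q : ℝ => 2 * q ^ (-ν) * Real.exp (-q ^ (-κ))) (nhdsWithin 0 (Ioi 0)) (nhds 0) := by
  have h1 : Tendsto (fun q : ℝ => q ^ (-κ)) (nhdsWithin 0 (Ioi 0)) atTop :=
    tendsto_rpow_neg_nhdsGT_zero (by linarith)
  have h2 := ((tendsto_rpow_mul_exp_neg_mul_atTop_nhds_zero (ν / κ) 1 one_pos).comp h1).const_mul 2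
  rw [mul_zero] at h2
  refine h2.congr' ?_
  filter_upwards [self_mem_nhdsWithin] with q hq
  have hq : 0 < q := hq
  simp only [Function.comp_apply]
  rw [← Real.rpow_mul hq.le]
  have : -κ * (ν / κ) = -ν := by field_simp
  rw [this]
  ring_nf

/-- If `∑ r n ^ b` diverges and `ν < b`, then almost surely every point of the circle is covered
infinitely often by the arcs with radii `r n ^ ν`. -/
theorem ae_forall_mem_limsupSet (hX : ∀ n, Measurable (X n))
    (hunif : ∀ n, P.map (X n) = (volume : Measure UnitAddCircle)) (hindep : iIndepFun X P)
    {r : ℕ → ℝ} (hr : ∀ n, 0 < r n ∧ r n ≤ 1) {ν b : ℝ} (hν : 0 ≤ ν) (hνb : ν < b)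
    (hdiv : ¬ Summable fun n => r n ^ b) :
    ∀ᵐ ω ∂P, ∀ ξ, ξ ∈ limsupSet (fun n => X n ω) fun n => r n ^ ν := by
  obtain ⟨a, hνa, hab⟩ := exists_between hνb
  have hbad : ∀ n₀ : ℕ, P {ω | ∃ ξ, ∀ n, n₀ ≤ n → r n ^ ν ≤ dist ξ (X n ω)} = 0 := by
    intro n₀
    refine le_antisymm (ENNReal.le_of_forall_pos_le_add fun ε hε _ => ?_) bot_le
    rw [zero_add]
    have hev := (tendsto_rpow_neg_mul_exp_neg_rpow_neg (ν := ν) (sub_pos.2 hνa)).eventually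
      (Iio_mem_nhds (show (0 : ℝ) < ε from hε))
    obtain ⟨t₀, ht₀, hsub⟩ := (mem_nhdsGT_iff_exists_Ioo_subset).1 hev
    obtain ⟨q, hq0, hq1, S, hS, hcard⟩ :=
      exists_card_ge_of_not_summable hr (hν.trans hνa.le) hab hdiv n₀
        (t₀ := min t₀ 1) (lt_min ht₀ one_pos) (min_le_right _ _)
    have hq2 : q < 1 := hq1.trans_le (min_le_right _ _)
    have hlt : 2 * q ^ (-ν) * Real.exp (-q ^ (-(a - ν))) < ε :=
      hsub ⟨hq0, hq1.trans_le (min_le_left _ _)⟩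
    calc P {ω | ∃ ξ, ∀ n, n₀ ≤ n → r n ^ ν ≤ dist ξ (X n ω)}
        ≤ P {ω | ∃ ξ, ∀ n ∈ S, q ^ ν ≤ dist ξ (X n ω)} := by
          refine measure_mono ?_
          rintro ω ⟨ξ, hξ⟩
          exact ⟨ξ, fun n hn => (Real.rpow_le_rpow hq0.le (hS n hn).2 hν).trans
            (hξ n (hS n hn).1)⟩
      _ ≤ ENNReal.ofReal (2 / q ^ ν * Real.exp (-(S.card * q ^ ν))) :=
          measure_exists_uncovered_le hX hunif hindep (by positivity)
            (Real.rpow_le_one hq0.le hq2.le hν) S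
      _ ≤ ENNReal.ofReal ε := by
          refine ENNReal.ofReal_le_ofReal (le_trans ?_ hlt.le)
          rw [Real.rpow_neg hq0.le ν, ← div_eq_mul_inv]
          gcongr
          calc q ^ (-(a - ν)) = q ^ (-a) * q ^ ν := by
                rw [← Real.rpow_add hq0]; ring_nf
            _ ≤ S.card * q ^ ν := by gcongr
      _ = ε := ENNReal.ofReal_coe_nnreal
  have hall : ∀ᵐ ω ∂P, ∀ n₀ : ℕ, ¬ ∃ ξ, ∀ n, n₀ ≤ n → r n ^ ν ≤ dist ξ (X n ω) :=
    ae_all_iff.2 fun n₀ => by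
      rw [ae_iff]
      simpa using hbad n₀
  filter_upwards [hall] with ω hω ξ
  refine frequently_atTop.2 fun n₀ => ?_
  by_contra! hcon
  exact hω n₀ ⟨ξ, hcon⟩

theorem ae_ofReal_le_approxExponent (hX : ∀ n, Measurable (X n))
    (hunif : ∀ n, P.map (X n) = (volume : Measure UnitAddCircle)) (hindep : iIndepFun X P)
    {r : ℕ → ℝ} (hr : ∀ n, 0 < r n ∧ r n ≤ 1) {ρ : ℝ} (hρ : 0 < ρ)
    (hdiv : ∀ ν : ℝ, ν < ρ → ¬ Summable (fun n => r n ^ ν)) :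
    ∀ᵐ ω ∂P, ∀ ξ, ENNReal.ofReal ρ ≤ approxExponent (fun n => X n ω) r ξ := by
  obtain ⟨u, -, hu, hlim⟩ := exists_seq_strictMono_tendsto' hρ
  have hall : ∀ᵐ ω ∂P, ∀ k, ∀ ξ, ξ ∈ limsupSet (fun n => X n ω) fun n => r n ^ u k := by
    refine ae_all_iff.2 fun k => ?_
    obtain ⟨b, hb, hb'⟩ := exists_between (hu k).2
    exact ae_forall_mem_limsupSet hX hunif hindep hr (hu k).1.le hb (hdiv b hb')
  filter_upwards [hall] with ω hω ξ
  refine ofReal_le_approxExponent fun κ _ hκ => ?_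
  obtain ⟨k, hk⟩ := (hlim.eventually (Ioi_mem_nhds hκ)).exists
  refine Frequently.mono (hω k ξ) fun n hn => lt_of_lt_of_le hn ?_
  exact Real.rpow_le_rpow_of_exponent_ge (hr n).1 (hr n).2 (le_of_lt hk)

/-- The expectation of the sum is of order `∑ r n ^ (ν * s) * (r n ^ ν) ^ (1 - γ)`. No independence
is used. -/
theorem ae_tsum_mem_thickening_lt_top (hX : ∀ n, Measurable (X n))
    (hunif : ∀ n, P.map (X n) = (volume : Measure UnitAddCircle))
    {r : ℕ → ℝ} (hr : ∀ n, 0 < r n ∧ r n ≤ 1) {G : Set UnitAddCircle} (hne : G.Nonempty) {γ : ℝ}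
    (hG : IsAhlforsRegular G γ) {ν s : ℝ} (hν : 0 ≤ ν)
    (hsum : Summable fun n => r n ^ (ν * (s + 1 - γ))) :
    ∀ᵐ ω ∂P, ∑' n, (X n ⁻¹' Metric.thickening (r n ^ ν) G).indicator
      (fun _ => ENNReal.ofReal (r n ^ (ν * s))) ω < ∞ := by
  obtain ⟨μ, hμ, -, -, c, hc, hlow, -⟩ := hG.exists_measure hne
  have hthick : ∀ n, volume (Metric.thickening (r n ^ ν) G) ≤
      (4 * c * μ univ + 2) * ENNReal.ofReal ((r n ^ ν) ^ (1 - γ)) := by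
    intro n
    have hpos : 0 < r n ^ ν := Real.rpow_pos_of_pos (hr n).1 _
    rcases le_or_gt (r n ^ ν) (1 / 2) with h | h
    · refine (volume_thickening_le μ hlow hpos h).trans ?_
      gcongr
      exact le_self_add
    · calc volume (Metric.thickening (r n ^ ν) G) ≤ 1 := by
            rw [← UnitAddCircle.measure_univ]; exact measure_mono (subset_univ _)
        _ ≤ 2 * ENNReal.ofReal ((r n ^ ν) ^ (1 - γ)) := by
            have h1 : r n ^ ν ≤ (r n ^ ν) ^ (1 - γ) := by
              conv_lhs => rw [← Real.rpow_one (r n ^ ν)]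
              exact Real.rpow_le_rpow_of_exponent_ge hpos (Real.rpow_le_one (hr n).1.le (hr n).2 hν)
                (by linarith [hG.dim_pos])
            rw [← ENNReal.ofReal_ofNat 2, ← ENNReal.ofReal_mul (by norm_num), ENNReal.one_le_ofReal]
            linarith
        _ ≤ _ := by gcongr; exact le_add_self
  have hset : ∀ n, MeasurableSet (X n ⁻¹' Metric.thickening (r n ^ ν) G) := fun n =>
    hX n Metric.isOpen_thickening.measurableSet
  have hmeas : ∀ n, Measurable ((X n ⁻¹' Metric.thickening (r n ^ ν) G).indicator
      fun _ => ENNReal.ofReal (r n ^ (ν * s))) := fun n => measurable_const.indicator (hset n)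
  refine ae_lt_top (Measurable.tsum hmeas) (ne_of_lt ?_)
  rw [lintegral_tsum fun n => (hmeas n).aemeasurable]
  calc ∑' n, ∫⁻ ω, (X n ⁻¹' Metric.thickening (r n ^ ν) G).indicator
        (fun _ => ENNReal.ofReal (r n ^ (ν * s))) ω ∂P
      ≤ ∑' n, (4 * c * μ univ + 2) * ENNReal.ofReal (r n ^ (ν * (s + 1 - γ))) := by
        refine ENNReal.tsum_le_tsum fun n => ?_
        rw [lintegral_indicator_const (hset n),
          ← Measure.map_apply (hX n) Metric.isOpen_thickening.measurableSet, hunif]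
        calc ENNReal.ofReal (r n ^ (ν * s)) * volume (Metric.thickening (r n ^ ν) G)
            ≤ ENNReal.ofReal (r n ^ (ν * s)) *
                ((4 * c * μ univ + 2) * ENNReal.ofReal ((r n ^ ν) ^ (1 - γ))) := by
              gcongr; exact hthick n
          _ = (4 * c * μ univ + 2) *
                ENNReal.ofReal (r n ^ (ν * s) * (r n ^ ν) ^ (1 - γ)) := by
              rw [ENNReal.ofReal_mul (Real.rpow_nonneg (hr n).1.le _)]; ring
          _ = _ := by
              rw [← Real.rpow_mul (hr n).1.le, ← Real.rpow_add (hr n).1]; ring_nf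
    _ < ∞ := by
        rw [ENNReal.tsum_mul_left]
        refine ENNReal.mul_lt_top ?_ (hsum.tsum_ofReal_lt_top)
        refine ENNReal.add_lt_top.2 ⟨ENNReal.mul_lt_top (ENNReal.mul_lt_top (by simp) hc.lt_top)
          (measure_lt_top _ _), by simp⟩

theorem ae_approxExponent_le (hX : ∀ n, Measurable (X n))
    (hunif : ∀ n, P.map (X n) = (volume : Measure UnitAddCircle))
    {r : ℕ → ℝ} (hr : ∀ n, 0 < r n ∧ r n ≤ 1) {ρ : ℝ} (hρ : 0 < ρ)
    (hconv : ∀ ν : ℝ, ρ < ν → Summable (fun n => r n ^ ν))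
    {G : Set UnitAddCircle} (hne : G.Nonempty) {γ : ℝ} (hG : IsAhlforsRegular G γ) :
    ∀ᵐ ω ∂P, ∀ ξ ∈ G, approxExponent (fun n => X n ω) r ξ ≤
      ENNReal.ofReal ρ / ENNReal.ofReal (1 - γ) := by
  rcases hG.dim_le_one.eq_or_lt with rfl | hγ
  -- For `γ = 1` the bound is a positive number divided by zero, that is, `∞`.
  · simp [hρ, ENNReal.div_zero]
  have hγ' : 0 < 1 - γ := sub_pos.2 hγ
  rw [← ENNReal.ofReal_div_of_pos hγ']
  have hall : ∀ᵐ ω ∂P, ∀ k : ℕ, ∑' n,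
      (X n ⁻¹' Metric.thickening (r n ^ (ρ / (1 - γ) + 1 / (k + 1))) G).indicator
        (fun _ => ENNReal.ofReal (r n ^ ((ρ / (1 - γ) + 1 / (k + 1 : ℝ)) * 0))) ω < ∞ := by
    refine ae_all_iff.2 fun k => ae_tsum_mem_thickening_lt_top hX hunif hr hne hG (by positivity)
      (hconv _ ?_)
    have : (ρ / (1 - γ) + 1 / (k + 1 : ℝ)) * (0 + 1 - γ) = ρ + 1 / (k + 1 : ℝ) * (1 - γ) := by
      rw [zero_add, add_mul, div_mul_cancel₀ _ hγ'.ne']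
    rw [this]
    exact lt_add_of_pos_right _ (by positivity)
  filter_upwards [hall] with ω hω ξ hξ
  by_contra! hlt
  obtain ⟨κ, hκ1, hκ2⟩ := ENNReal.lt_iff_exists_nnreal_btwn.1 hlt
  have hκ1' : ρ / (1 - γ) < κ := by
    rw [← ENNReal.ofReal_coe_nnreal] at hκ1
    exact (ENNReal.ofReal_lt_ofReal_iff_of_nonneg (by positivity)).1 hκ1
  obtain ⟨k, hk⟩ := exists_nat_one_div_lt (sub_pos.2 hκ1')
  have hmem : ξ ∈ limsupSet (fun n => X n ω) fun n => r n ^ (ρ / (1 - γ) + 1 / (k + 1 : ℝ)) := by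
    refine mem_limsupSet_rpow_of_lt hr (lt_of_le_of_lt ?_ hκ2)
    rw [← ENNReal.ofReal_coe_nnreal]
    exact ENNReal.ofReal_le_ofReal (by linarith)
  -- With `s = 0` each term is `0` or `1`, so finiteness of the sum leaves only finitely many `n`
  -- with `X n ω` close to `G`.
  have hzero := ENNReal.tendsto_atTop_zero_of_tsum_ne_top (hω k).ne
  have hev := hzero.eventually (Iio_mem_nhds one_pos)
  obtain ⟨n, hn, hn'⟩ := (Frequently.and_eventually hmem hev).exists
  rw [indicator_of_mem] at hn'
  · simp at hn'
  · exact Metric.mem_thickening_iff.2 ⟨ξ, hξ, by rwa [dist_comm]⟩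

/-- Every tail of `E` covers the limsup set, and its sets have diameter at most the tail sum to the
power `1 / s`, which tends to zero. -/
theorem hausdorffMeasure_frequently_eq_zero {Y : Type*} [EMetricSpace Y] [MeasurableSpace Y]
    [BorelSpace Y] {s : ℝ} (hs : 0 < s) {E : ℕ → Set Y}
    (hE : ∑' n, Metric.ediam (E n) ^ s ≠ ∞) :
    Measure.hausdorffMeasure s {y | ∃ᶠ n in atTop, y ∈ E n} = 0 := by
  have htail := ENNReal.tendsto_sum_nat_add _ hE
  refine le_antisymm ?_ bot_le
  refine (Measure.hausdorffMeasure_le_liminf_tsum (l := atTop) s _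
    (fun N : ℕ => (∑' k, Metric.ediam (E (k + N)) ^ s) ^ s⁻¹) ?_ (fun N k => E (k + N)) ?_ ?_).trans
    htail.liminf_eq.le
  · have := (ENNReal.continuous_rpow_const (y := s⁻¹)).continuousAt.tendsto.comp htail
    simpa [ENNReal.zero_rpow_of_pos (inv_pos.2 hs), Function.comp_def] using this
  · refine Eventually.of_forall fun N k => ?_
    rw [← ENNReal.rpow_le_rpow_iff hs, ENNReal.rpow_inv_rpow hs.ne']
    exact ENNReal.le_tsum (f := fun k => Metric.ediam (E (k + N)) ^ s) k
  · refine Eventually.of_forall fun N y hy => ?_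
    obtain ⟨n, hn, hy⟩ := (frequently_atTop.1 hy) N
    refine mem_iUnion.2 ⟨n - N, ?_⟩
    rwa [Nat.sub_add_cancel hn]

theorem ae_dimH_limsupSet_le (hX : ∀ n, Measurable (X n))
    (hunif : ∀ n, P.map (X n) = (volume : Measure UnitAddCircle))
    {r : ℕ → ℝ} (hr : ∀ n, 0 < r n ∧ r n ≤ 1) {G : Set UnitAddCircle} (hne : G.Nonempty) {γ : ℝ}
    (hG : IsAhlforsRegular G γ) {ν : ℝ} (hν : 0 ≤ ν) {s : ℝ≥0} (hs : 0 < s)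
    (hsum : Summable fun n => r n ^ (ν * (s + 1 - γ))) :
    ∀ᵐ ω ∂P, dimH (G ∩ limsupSet (fun n => X n ω) fun n => r n ^ ν) ≤ s := by
  filter_upwards [ae_tsum_mem_thickening_lt_top hX hunif hr hne hG hν hsum] with ω hω
  refine dimH_le_of_hausdorffMeasure_ne_top (ne_of_eq_of_ne ?_ ENNReal.zero_ne_top)
  -- The first condition does not involve `ξ`: it empties `E n` when `X n ω` is far from `G`, so
  -- only arcs near `G` contribute.
  set E : ℕ → Set UnitAddCircle := fun n =>
    {ξ | X n ω ∈ Metric.thickening (r n ^ ν) G ∧ dist ξ (X n ω) < r n ^ ν} with hE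
  refine measure_mono_null (t := {ξ | ∃ᶠ n in atTop, ξ ∈ E n}) ?_
    (hausdorffMeasure_frequently_eq_zero (by exact_mod_cast hs) (ne_of_lt ?_))
  · rintro ξ ⟨hξ, hmem⟩
    exact Frequently.mono hmem fun n hn =>
      ⟨Metric.mem_thickening_iff.2 ⟨ξ, hξ, by rwa [dist_comm]⟩, hn⟩
  · have hs' : (0 : ℝ) < s := by exact_mod_cast hs
    calc ∑' n, Metric.ediam (E n) ^ (s : ℝ)
        ≤ ∑' n, 2 ^ (s : ℝ) * (X n ⁻¹' Metric.thickening (r n ^ ν) G).indicator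
            (fun _ => ENNReal.ofReal (r n ^ (ν * s))) ω := by
          refine ENNReal.tsum_le_tsum fun n => ?_
          by_cases h : X n ω ∈ Metric.thickening (r n ^ ν) G
          · have hpos : 0 < r n ^ ν := Real.rpow_pos_of_pos (hr n).1 _
            rw [indicator_of_mem (show ω ∈ X n ⁻¹' Metric.thickening (r n ^ ν) G from h),
              Real.rpow_mul (hr n).1.le,
              ← ENNReal.ofReal_rpow_of_pos hpos, ← ENNReal.mul_rpow_of_nonneg _ _ hs'.le]
            refine ENNReal.rpow_le_rpow ?_ hs'.le
            calc Metric.ediam (E n) ≤ Metric.ediam (Metric.closedBall (X n ω) (r n ^ ν)) :=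
                  Metric.ediam_mono fun ξ hξ => hξ.2.le
              _ ≤ 2 * ENNReal.ofReal (r n ^ ν) := by
                  rw [← Metric.closedEBall_ofReal hpos.le]
                  exact Metric.ediam_closedEBall_le
          · have : E n = ∅ := by
              ext ξ; simp [hE, h]
            simp [this, ENNReal.zero_rpow_of_pos hs']
      _ < ∞ := by
          rw [ENNReal.tsum_mul_left]
          exact ENNReal.mul_lt_top
            (ENNReal.rpow_lt_top_of_nonneg hs'.le (by simp)) hω

theorem ae_dimH_approxExponent_le (hX : ∀ n, Measurable (X n))
    (hunif : ∀ n, P.map (X n) = (volume : Measure UnitAddCircle))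
    {r : ℕ → ℝ} (hr : ∀ n, 0 < r n ∧ r n ≤ 1) {ρ : ℝ} (hρ : 0 < ρ)
    (hconv : ∀ ν : ℝ, ρ < ν → Summable (fun n => r n ^ ν))
    {G : Set UnitAddCircle} (hne : G.Nonempty) {γ : ℝ} (hG : IsAhlforsRegular G γ)
    {ν : ℝ} (hν : 0 < ν) (hνγ : (1 - γ) * ν ≤ ρ) :
    ∀ᵐ ω ∂P, dimH {ξ ∈ G | ENNReal.ofReal ν ≤ approxExponent (fun n => X n ω) r ξ} ≤
      ENNReal.ofReal (ρ / ν + γ - 1) := by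
  have hs₀ : 0 ≤ ρ / ν + γ - 1 := by
    have : 1 - γ ≤ ρ / ν := (le_div_iff₀ hν).2 hνγ
    linarith
  have hall : ∀ᵐ ω ∂P, ∀ k : ℕ,
      dimH {ξ ∈ G | ENNReal.ofReal ν ≤ approxExponent (fun n => X n ω) r ξ} ≤
        ENNReal.ofReal (ρ / ν + γ - 1 + 1 / (k + 1 : ℝ)) := by
    refine ae_all_iff.2 fun k => ?_
    have hk : (0 : ℝ) < 1 / (k + 1 : ℝ) := by positivity
    set s : ℝ := ρ / ν + γ - 1 + 1 / (k + 1 : ℝ) with hs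
    have hspos : 0 < s := by linarith
    have h1 : 0 < s + 1 - γ := by
      have : 0 < ρ / ν := by positivity
      linarith
    have h2 : ρ / (s + 1 - γ) < ν := by
      rw [div_lt_iff₀ h1]
      have : ν * (s + 1 - γ) = ρ + ν * (1 / (k + 1 : ℝ)) := by
        rw [hs]; field_simp; ring
      rw [this]
      exact lt_add_of_pos_right _ (by positivity)
    -- An exponent at least `ν` only gives membership in the limsup sets for `κ < ν`; the margin `1
    -- / (k + 1)` in `s` leaves room for `κ * (s + 1 - γ) > ρ`.
    obtain ⟨κ, hκ1, hκ2⟩ := exists_between h2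
    have hκ0 : 0 ≤ κ := le_trans (by positivity) hκ1.le
    have := ae_dimH_limsupSet_le hX hunif hr hne hG hκ0 (s := s.toNNReal)
      (by simpa using hspos)
      (hconv _ (by rw [Real.coe_toNNReal _ hspos.le]; exact (div_lt_iff₀ h1).1 hκ1))
    filter_upwards [this] with ω hω
    refine (dimH_mono ?_).trans hω
    rintro ξ ⟨hξ, hle⟩
    refine ⟨hξ, mem_limsupSet_rpow_of_lt hr (lt_of_lt_of_le ?_ hle)⟩
    exact (ENNReal.ofReal_lt_ofReal_iff hν).2 hκ2
  filter_upwards [hall] with ω hω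
  have ht : Tendsto (fun k : ℕ => ENNReal.ofReal (ρ / ν + γ - 1 + 1 / (k + 1 : ℝ))) atTop
      (nhds (ENNReal.ofReal (ρ / ν + γ - 1 + 0))) :=
    ENNReal.tendsto_ofReal (tendsto_one_div_add_atTop_nhds_zero_nat.const_add _)
  rw [add_zero] at ht
  exact ge_of_tendsto' ht hω

end Covering

/-! ### Random densities built from one block of points. -/

section Block

variable {Ω : Type*} {X : ℕ → Ω → UnitAddCircle}

/-- The function `a` times the indicator of the pairs at distance at most `t`. -/
noncomputable def nearIndicator (a : ℝ≥0∞) (t : ℝ) (p : UnitAddCircle × UnitAddCircle) : ℝ≥0∞ :=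
  {q : UnitAddCircle × UnitAddCircle | dist q.1 q.2 ≤ t}.indicator (fun _ => a) p

theorem nearIndicator_of_le {a : ℝ≥0∞} {t : ℝ} {x y : UnitAddCircle} (h : dist x y ≤ t) :
    nearIndicator a t (x, y) = a :=
  indicator_of_mem (show (x, y) ∈ {q : UnitAddCircle × UnitAddCircle | dist q.1 q.2 ≤ t} from h) _

theorem nearIndicator_of_lt {a : ℝ≥0∞} {t : ℝ} {x y : UnitAddCircle} (h : t < dist x y) :
    nearIndicator a t (x, y) = 0 :=
  indicator_of_notMem
    (show (x, y) ∉ {q : UnitAddCircle × UnitAddCircle | dist q.1 q.2 ≤ t} from not_le.2 h) _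

theorem nearIndicator_le (a : ℝ≥0∞) (t : ℝ) (p : UnitAddCircle × UnitAddCircle) :
    nearIndicator a t p ≤ a :=
  indicator_le (fun _ _ => le_rfl) p

theorem measurable_nearIndicator (a : ℝ≥0∞) (t : ℝ) : Measurable (nearIndicator a t) :=
  measurable_const.indicator (isClosed_le (by fun_prop) continuous_const).measurableSet

theorem nearIndicator_eq_indicator_closedBall (a : ℝ≥0∞) (t : ℝ) (x y : UnitAddCircle) :
    nearIndicator a t (x, y) = (Metric.closedBall y t).indicator (fun _ => a) x := rfl

/-- A weighted sum of indicators of the closed arcs of radius `δ n` centered at `X n`. -/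
noncomputable def blockDensity (X : ℕ → Ω → UnitAddCircle) (S : Finset ℕ) (w : ℕ → ℝ≥0∞)
    (δ : ℕ → ℝ) (ω : Ω) (ξ : UnitAddCircle) : ℝ≥0∞ :=
  ∑ n ∈ S, nearIndicator (w n) (δ n) (X n ω, ξ)

/-- The covariance bound for `blockDensity`. -/
noncomputable def blockCorrelation (S : Finset ℕ) (w : ℕ → ℝ≥0∞) (δ : ℕ → ℝ)
    (ξ η : UnitAddCircle) : ℝ≥0∞ :=
  ∑ n ∈ S, nearIndicator (w n ^ 2 * ENNReal.ofReal (2 * δ n)) (2 * δ n) (ξ, η)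

theorem measurable_iSup_comap_blockDensity (S : Finset ℕ) (w : ℕ → ℝ≥0∞) (δ : ℕ → ℝ)
    (ξ : UnitAddCircle) {T : Set ℕ} (hS : ∀ n ∈ S, n ∈ T) :
    Measurable[⨆ n ∈ T, MeasurableSpace.comap (X n) inferInstance]
      fun ω => blockDensity X S w δ ω ξ := by
  refine Finset.measurable_sum S fun n hn => ?_
  have h1 : Measurable fun x => nearIndicator (w n) (δ n) (x, ξ) :=
    (measurable_nearIndicator _ _).comp (by fun_prop)
  have h2 : Measurable[MeasurableSpace.comap (X n) inferInstance] (X n) := comap_measurable _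
  exact (h1.comp h2).mono (le_iSup₂_of_le n (hS n hn) le_rfl) le_rfl

theorem blockDensity_le (S : Finset ℕ) (w : ℕ → ℝ≥0∞) (δ : ℕ → ℝ) (ω : Ω) (ξ : UnitAddCircle) :
    blockDensity X S w δ ω ξ ≤ ∑ n ∈ S, w n :=
  Finset.sum_le_sum fun _ _ => nearIndicator_le _ _ _

theorem blockDensity_ne_zero_iff {S : Finset ℕ} {w : ℕ → ℝ≥0∞} (hw : ∀ n ∈ S, w n ≠ 0)
    {δ : ℕ → ℝ} {ω : Ω} {ξ : UnitAddCircle} :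
    blockDensity X S w δ ω ξ ≠ 0 ↔ ∃ n ∈ S, dist ξ (X n ω) ≤ δ n := by
  rw [blockDensity, Ne, Finset.sum_eq_zero_iff]
  push Not
  refine exists_congr fun n => and_congr_right fun hn => ?_
  rw [dist_comm]
  constructor
  · intro h
    by_contra! hlt
    exact h (nearIndicator_of_lt hlt)
  · intro h
    rw [nearIndicator_of_le h]
    exact hw n hn

theorem isClosed_blockDensity_ne_zero {S : Finset ℕ} {w : ℕ → ℝ≥0∞} (hw : ∀ n ∈ S, w n ≠ 0)
    (δ : ℕ → ℝ) (ω : Ω) : IsClosed {ξ | blockDensity X S w δ ω ξ ≠ 0} := by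
  have : {ξ | blockDensity X S w δ ω ξ ≠ 0} = ⋃ n ∈ S, Metric.closedBall (X n ω) (δ n) := by
    ext ξ
    simp only [mem_ofPred_eq, blockDensity_ne_zero_iff hw, mem_iUnion, Metric.mem_closedBall,
      exists_prop]
  rw [this]
  exact S.finite_toSet.isClosed_biUnion fun _ _ => Metric.isClosed_closedBall

variable [MeasurableSpace Ω] {P : Measure Ω}

theorem measurable_nearIndicator_comp (hX : ∀ n, Measurable (X n)) (a : ℝ≥0∞) (t : ℝ) (n : ℕ)
    (ξ : UnitAddCircle) : Measurable fun ω => nearIndicator a t (X n ω, ξ) :=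
  (measurable_nearIndicator a t).comp ((hX n).prodMk measurable_const)

theorem lintegral_nearIndicator (hX : ∀ n, Measurable (X n))
    (hunif : ∀ n, P.map (X n) = (volume : Measure UnitAddCircle)) (a : ℝ≥0∞) {t : ℝ}
    (ht : t ≤ 1 / 2) (n : ℕ) (ξ : UnitAddCircle) :
    ∫⁻ ω, nearIndicator a t (X n ω, ξ) ∂P = a * ENNReal.ofReal (2 * t) := by
  have hm : Measurable fun x => nearIndicator a t (x, ξ) :=
    (measurable_nearIndicator a t).comp (by fun_prop)
  rw [← lintegral_map (f := fun x => nearIndicator a t (x, ξ)) hm (hX n), hunif]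
  simp only [nearIndicator_eq_indicator_closedBall]
  rw [lintegral_indicator_const Metric.isClosed_closedBall.measurableSet,
    volume_unitAddCircle_closedBall ht]

/-- One arc of radius `t` cannot contain two points more than `2 * t` apart; otherwise one factor is
bounded by `a`. -/
theorem lintegral_nearIndicator_mul_self_le (hX : ∀ n, Measurable (X n))
    (hunif : ∀ n, P.map (X n) = (volume : Measure UnitAddCircle)) (a : ℝ≥0∞) {t : ℝ}
    (ht : t ≤ 1 / 2) (n : ℕ) (ξ η : UnitAddCircle) :
    ∫⁻ ω, nearIndicator a t (X n ω, ξ) * nearIndicator a t (X n ω, η) ∂P ≤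
      nearIndicator (a ^ 2 * ENNReal.ofReal (2 * t)) (2 * t) (ξ, η) := by
  rcases le_or_gt (dist ξ η) (2 * t) with h | h
  · rw [nearIndicator_of_le h]
    calc ∫⁻ ω, nearIndicator a t (X n ω, ξ) * nearIndicator a t (X n ω, η) ∂P
        ≤ ∫⁻ ω, nearIndicator a t (X n ω, ξ) * a ∂P := by
          gcongr with ω; exact nearIndicator_le _ _ _
      _ = a ^ 2 * ENNReal.ofReal (2 * t) := by
          rw [lintegral_mul_const _ (measurable_nearIndicator_comp hX a t n ξ),
            lintegral_nearIndicator hX hunif a ht]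
          ring
  · refine le_of_eq_of_le ?_ bot_le
    have : ∀ ω, nearIndicator a t (X n ω, ξ) * nearIndicator a t (X n ω, η) = 0 := by
      intro ω
      rcases le_or_gt (dist (X n ω) ξ) t with h1 | h1
      · rw [nearIndicator_of_lt (x := X n ω) (y := η), mul_zero]
        linarith [dist_triangle ξ (X n ω) η, dist_comm ξ (X n ω)]
      · rw [nearIndicator_of_lt h1, zero_mul]
    simp only [this, lintegral_zero]
    rfl

theorem measurable_blockDensity (hX : ∀ n, Measurable (X n)) (S : Finset ℕ) (w : ℕ → ℝ≥0∞)
    (δ : ℕ → ℝ) : Measurable (Function.uncurry (blockDensity X S w δ)) := by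
  refine Finset.measurable_sum S fun n _ => ?_
  exact (measurable_nearIndicator (w n) (δ n)).comp
    (((hX n).comp measurable_fst).prodMk measurable_snd)

theorem lintegral_blockDensity (hX : ∀ n, Measurable (X n))
    (hunif : ∀ n, P.map (X n) = (volume : Measure UnitAddCircle)) {S : Finset ℕ} {w : ℕ → ℝ≥0∞}
    {δ : ℕ → ℝ} (hδ : ∀ n ∈ S, δ n ≤ 1 / 2) (ξ : UnitAddCircle) :
    ∫⁻ ω, blockDensity X S w δ ω ξ ∂P = ∑ n ∈ S, w n * ENNReal.ofReal (2 * δ n) := by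
  unfold blockDensity
  rw [lintegral_finsetSum _ fun n _ => measurable_nearIndicator_comp hX (w n) (δ n) n ξ]
  exact Finset.sum_congr rfl fun n hn => lintegral_nearIndicator hX hunif _ (hδ n hn) n ξ

/-- Distinct indices are independent and contribute products of means, at most `(∑ p n) ^ 2 = 1` in
total; the diagonal contributes `blockCorrelation`. -/
theorem lintegral_blockDensity_mul_le (hX : ∀ n, Measurable (X n))
    (hunif : ∀ n, P.map (X n) = (volume : Measure UnitAddCircle)) (hindep : iIndepFun X P)
    {S : Finset ℕ} {w : ℕ → ℝ≥0∞} {δ : ℕ → ℝ} (hδ : ∀ n ∈ S, δ n ≤ 1 / 2)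
    (hone : ∑ n ∈ S, w n * ENNReal.ofReal (2 * δ n) = 1) (ξ η : UnitAddCircle) :
    ∫⁻ ω, blockDensity X S w δ ω ξ * blockDensity X S w δ ω η ∂P ≤
      1 + blockCorrelation S w δ ξ η := by
  have hm : ∀ n ζ, Measurable fun ω => nearIndicator (w n) (δ n) (X n ω, ζ) := fun n ζ =>
    measurable_nearIndicator_comp hX _ _ n ζ
  have hm2 : ∀ n k, Measurable fun ω => nearIndicator (w n) (δ n) (X n ω, ξ) *
      nearIndicator (w k) (δ k) (X k ω, η) := fun n k => (hm n ξ).mul (hm k η)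
  have hm' : ∀ n ζ, Measurable fun x => nearIndicator (w n) (δ n) (x, ζ) := fun n ζ =>
    (measurable_nearIndicator _ _).comp (by fun_prop)
  set p : ℕ → ℝ≥0∞ := fun n => w n * ENNReal.ofReal (2 * δ n) with hp
  set v : ℕ → ℝ≥0∞ := fun n =>
    nearIndicator (w n ^ 2 * ENNReal.ofReal (2 * δ n)) (2 * δ n) (ξ, η) with hv
  have hterm : ∀ n ∈ S, ∀ k ∈ S, ∫⁻ ω, nearIndicator (w n) (δ n) (X n ω, ξ) *
      nearIndicator (w k) (δ k) (X k ω, η) ∂P ≤ p n * p k + if n = k then v n else 0 := by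
    intro n hn k hk
    by_cases hnk : n = k
    · subst hnk
      rw [if_pos rfl]
      exact (lintegral_nearIndicator_mul_self_le hX hunif _ (hδ n hn) n ξ η).trans le_add_self
    · rw [if_neg hnk, add_zero]
      have hind : IndepFun (fun ω => nearIndicator (w n) (δ n) (X n ω, ξ))
          (fun ω => nearIndicator (w k) (δ k) (X k ω, η)) P :=
        (hindep.indepFun hnk).comp (hm' n ξ) (hm' k η)
      have := lintegral_mul_eq_lintegral_mul_lintegral_of_indepFun (hm n ξ) (hm k η) hind
      simp only [Pi.mul_apply] at this
      rw [this, lintegral_nearIndicator hX hunif _ (hδ n hn),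
        lintegral_nearIndicator hX hunif _ (hδ k hk)]
  calc ∫⁻ ω, blockDensity X S w δ ω ξ * blockDensity X S w δ ω η ∂P
      = ∑ n ∈ S, ∑ k ∈ S, ∫⁻ ω, nearIndicator (w n) (δ n) (X n ω, ξ) *
          nearIndicator (w k) (δ k) (X k ω, η) ∂P := by
        simp only [blockDensity, Finset.sum_mul_sum]
        rw [lintegral_finsetSum _ fun n _ => Finset.measurable_sum _ fun k _ => hm2 n k]
        refine Finset.sum_congr rfl fun n _ => ?_
        rw [lintegral_finsetSum _ fun k _ => hm2 n k]
    _ ≤ ∑ n ∈ S, ∑ k ∈ S, (p n * p k + if n = k then v n else 0) :=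
        Finset.sum_le_sum fun n hn => Finset.sum_le_sum fun k hk => hterm n hn k hk
    _ = (∑ n ∈ S, p n) * (∑ k ∈ S, p k) + ∑ n ∈ S, v n := by
        simp only [Finset.sum_add_distrib, Finset.sum_mul_sum]
        congr 1
        refine Finset.sum_congr rfl fun n hn => ?_
        rw [Finset.sum_ite_eq, if_pos hn]
    _ = 1 + blockCorrelation S w δ ξ η := by rw [hone, one_mul]; rfl

theorem measurable_blockCorrelation (S : Finset ℕ) (w : ℕ → ℝ≥0∞) (δ : ℕ → ℝ) :
    Measurable (Function.uncurry (blockCorrelation S w δ)) :=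
  Finset.measurable_sum S fun _ _ => (measurable_nearIndicator _ _)

theorem blockCorrelation_le (S : Finset ℕ) (w : ℕ → ℝ≥0∞) (δ : ℕ → ℝ) (ξ η : UnitAddCircle) :
    blockCorrelation S w δ ξ η ≤ ∑ n ∈ S, w n ^ 2 * ENNReal.ofReal (2 * δ n) :=
  Finset.sum_le_sum fun _ _ => nearIndicator_le _ _ _

theorem measurable_edist_rpow (s : ℝ) :
    Measurable fun p : UnitAddCircle × UnitAddCircle => edist p.1 p.2 ^ s :=
  (measurable_fst.edist measurable_snd).pow_const s

theorem lintegral_nearIndicator_mul (μ : Measure UnitAddCircle) (a : ℝ≥0∞) (t : ℝ)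
    (ξ : UnitAddCircle) {k : UnitAddCircle → ℝ≥0∞} (hk : Measurable k) :
    ∫⁻ η, nearIndicator a t (ξ, η) * k η ∂μ = a * ∫⁻ η in Metric.closedBall ξ t, k η ∂μ := by
  rw [← lintegral_const_mul _ hk, ← lintegral_indicator Metric.isClosed_closedBall.measurableSet]
  refine lintegral_congr fun η => ?_
  rcases le_or_gt (dist ξ η) t with h | h
  · rw [nearIndicator_of_le h, indicator_of_mem]
    rwa [Metric.mem_closedBall, dist_comm]
  · rw [nearIndicator_of_lt h, indicator_of_notMem, zero_mul]
    rwa [Metric.mem_closedBall, dist_comm, not_le]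

theorem lintegral_blockCorrelation_mul_le {G : Set UnitAddCircle} {γ s : ℝ}
    (μ : Measure UnitAddCircle) (hGμ : μ Gᶜ = 0) {C : ℝ≥0∞}
    (hC : ∀ x ∈ G, ∀ u : ℝ, 0 < u →
      ∫⁻ y in Metric.closedBall x u, edist x y ^ (-s) ∂μ ≤ C * ENNReal.ofReal (u ^ (γ - s)))
    {S : Finset ℕ} {w : ℕ → ℝ≥0∞} {δ : ℕ → ℝ} (hδ : ∀ n ∈ S, 0 < δ n) :
    ∫⁻ ξ, ∫⁻ η, blockCorrelation S w δ ξ η * edist ξ η ^ (-s) ∂μ ∂μ ≤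
      (∑ n ∈ S, w n ^ 2 * ENNReal.ofReal (2 * δ n) *
        (C * ENNReal.ofReal ((2 * δ n) ^ (γ - s)))) * μ univ := by
  have hinner : ∀ ξ ∈ G, ∫⁻ η, blockCorrelation S w δ ξ η * edist ξ η ^ (-s) ∂μ ≤
      ∑ n ∈ S, w n ^ 2 * ENNReal.ofReal (2 * δ n) *
        (C * ENNReal.ofReal ((2 * δ n) ^ (γ - s))) := by
    intro ξ hξ
    have hk : Measurable fun η => edist ξ η ^ (-s) :=
      (measurable_const.edist measurable_id).pow_const (-s)
    have hn : ∀ n, Measurable fun η => nearIndicator (w n ^ 2 * ENNReal.ofReal (2 * δ n))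
        (2 * δ n) (ξ, η) * edist ξ η ^ (-s) := fun n =>
      ((measurable_nearIndicator (w n ^ 2 * ENNReal.ofReal (2 * δ n)) (2 * δ n)).comp
        (measurable_const.prodMk measurable_id)).mul hk
    simp only [blockCorrelation, Finset.sum_mul]
    rw [lintegral_finsetSum _ fun n _ => hn n]
    refine Finset.sum_le_sum fun n hnS => ?_
    rw [lintegral_nearIndicator_mul μ _ _ ξ hk]
    exact mul_le_mul_right (hC ξ hξ _ (by have := hδ n hnS; positivity)) _
  have hae : ∀ᵐ ξ ∂μ, ξ ∈ G := by rw [ae_iff]; exact hGμ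
  refine (lintegral_mono_ae (hae.mono hinner)).trans_eq ?_
  rw [lintegral_const]

/-- There are weights on a finite block of large indices for which `blockDensity` has mean one and
covariance of small energy. -/
theorem exists_block_of_not_summable {r : ℕ → ℝ} (hr : ∀ n, 0 < r n)
    (hr0 : Tendsto r atTop (nhds 0)) {G : Set UnitAddCircle} {γ s : ℝ}
    (μ : Measure UnitAddCircle) [IsFiniteMeasure μ] (hGμ : μ Gᶜ = 0) {C : ℝ≥0∞} (hCtop : C ≠ ∞)
    (hC : ∀ x ∈ G, ∀ u : ℝ, 0 < u →
      ∫⁻ y in Metric.closedBall x u, edist x y ^ (-s) ∂μ ≤ C * ENNReal.ofReal (u ^ (γ - s)))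
    {κ : ℝ} (hκ : 0 < κ) (hdiv : ¬ Summable fun n => r n ^ (κ * (1 + s - γ))) (n₀ : ℕ)
    {ε : ℝ≥0∞} (hε : ε ≠ 0) :
    ∃ (S : Finset ℕ) (w : ℕ → ℝ≥0∞), (∀ n ∈ S, n₀ ≤ n) ∧ (∀ n ∈ S, w n ≠ 0) ∧
      (∀ n ∈ S, w n ≠ ∞) ∧ (∀ n ∈ S, r n ^ κ ≤ 1 / 2) ∧
      ∑ n ∈ S, w n * ENNReal.ofReal (2 * r n ^ κ) = 1 ∧
      ∫⁻ ξ, ∫⁻ η, blockCorrelation S w (fun n => r n ^ κ) ξ η * edist ξ η ^ (-s) ∂μ ∂μ ≤ ε := by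
  have hδpos : ∀ n, 0 < r n ^ κ := fun n => Real.rpow_pos_of_pos (hr n) κ
  have hsmall : ∀ᶠ n in atTop, r n ^ κ ≤ 1 / 2 := by
    have h1 := (Real.continuousAt_rpow_const 0 κ (Or.inr hκ.le)).tendsto.comp hr0
    rw [Real.zero_rpow hκ.ne'] at h1
    exact h1.eventually (Iic_mem_nhds (by norm_num))
  obtain ⟨n₁, hn₁⟩ := eventually_atTop.1 hsmall
  set T : ℝ≥0∞ := C * ENNReal.ofReal (2 ^ (γ - s)) * μ univ with hT
  have hTtop : T ≠ ∞ :=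
    ENNReal.mul_ne_top (ENNReal.mul_ne_top hCtop (by simp)) (measure_ne_top _ _)
  obtain ⟨l₀, hl₀, hl₀ε⟩ : ∃ l : ℝ, 0 < l ∧ T * ENNReal.ofReal l ≤ ε := by
    have ht : Tendsto (fun l : ℝ => T * ENNReal.ofReal l) (nhdsWithin 0 (Ioi 0)) (nhds 0) := by
      have h2 := ((ENNReal.continuous_const_mul hTtop).comp ENNReal.continuous_ofReal).tendsto 0
      simpa [Function.comp_def] using h2.mono_left (nhdsWithin_le_nhds (s := Ioi (0 : ℝ)))
    obtain ⟨l, h1, h2⟩ := ((ht.eventually (Iio_mem_nhds (pos_iff_ne_zero.2 hε))).and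
      self_mem_nhdsWithin).exists
    exact ⟨l, h2, le_of_lt h1⟩
  set a : ℕ → ℝ := fun n => r n ^ (κ * (1 + s - γ)) with ha
  have hapos : ∀ n, 0 < a n := fun n => Real.rpow_pos_of_pos (hr n) _
  obtain ⟨S, hS, hL⟩ := exists_sum_ge_of_not_summable (fun n => (hapos n).le) hdiv (max n₀ n₁)
    (1 / (2 * l₀))
  set A : ℝ := ∑ n ∈ S, a n with hA
  have hApos : 0 < A := lt_of_lt_of_le (by positivity) hL
  set l : ℝ := 1 / (2 * A) with hl
  have hlpos : 0 < l := by positivity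
  have hle : l ≤ l₀ := by
    rw [hl, div_le_iff₀ (by positivity)]
    rw [div_le_iff₀ (by positivity)] at hL
    linarith
  have hlA : 2 * l * A = 1 := by rw [hl]; field_simp
  have ha' : ∀ n, a n = (r n ^ κ) ^ (1 + s - γ) := fun n => by
    rw [ha, ← Real.rpow_mul (hr n).le]
  -- With `δ = r n ^ κ` and weights `l * δ ^ (s - γ)`, the mean is `2 * l * A = 1`, while the energy
  -- is at most a constant times `∑ 2 * l ^ 2 * δ ^ (1 + s - γ) = l`. Divergence makes `A` large,
  -- hence `l` small.
  refine ⟨S, fun n => ENNReal.ofReal (l * (r n ^ κ) ^ (s - γ)),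
    fun n hn => (le_max_left _ _).trans (hS n hn), fun n _ => ?_, fun n _ => ENNReal.ofReal_ne_top,
    fun n hn => hn₁ n ((le_max_right _ _).trans (hS n hn)), ?_, ?_⟩
  · have := hδpos n
    rw [Ne, ENNReal.ofReal_eq_zero, not_le]
    positivity
  · rw [← ENNReal.ofReal_one, ← hlA, hA, Finset.mul_sum,
      ENNReal.ofReal_sum_of_nonneg fun n _ => by have := hapos n; positivity]
    refine Finset.sum_congr rfl fun n _ => ?_
    have := hδpos n
    rw [← ENNReal.ofReal_mul (by positivity), ha',
      show 1 + s - γ = (s - γ) + 1 by ring, Real.rpow_add this, Real.rpow_one]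
    ring_nf
  · refine (lintegral_blockCorrelation_mul_le μ hGμ hC fun n _ => hδpos n).trans ?_
    calc (∑ n ∈ S, ENNReal.ofReal (l * (r n ^ κ) ^ (s - γ)) ^ 2 * ENNReal.ofReal (2 * r n ^ κ) *
          (C * ENNReal.ofReal ((2 * r n ^ κ) ^ (γ - s)))) * μ univ
        = (∑ n ∈ S, C * ENNReal.ofReal (2 ^ (γ - s)) * ENNReal.ofReal (2 * l * l * a n)) *
            μ univ := by
          congr 1
          refine Finset.sum_congr rfl fun n _ => ?_
          have hδ := hδpos n
          have e : (l * (r n ^ κ) ^ (s - γ)) ^ 2 * (2 * r n ^ κ) * (2 * r n ^ κ) ^ (γ - s) =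
              2 ^ (γ - s) * (2 * l * l * a n) := by
            have e1 : a n = (r n ^ κ) ^ (s - γ) * ((r n ^ κ) ^ (s - γ) * (r n ^ κ) ^ (γ - s)) *
                r n ^ κ := by
              rw [← Real.rpow_add hδ, show s - γ + (γ - s) = 0 by ring, Real.rpow_zero, mul_one,
                ha', show 1 + s - γ = (s - γ) + 1 by ring, Real.rpow_add hδ, Real.rpow_one]
            rw [e1, Real.mul_rpow (by norm_num) hδ.le]
            ring
          have hp2 : (0 : ℝ) ≤ 2 ^ (γ - s) := by positivity
          calc _ = C * ENNReal.ofReal ((l * (r n ^ κ) ^ (s - γ)) ^ 2 * (2 * r n ^ κ) *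
                (2 * r n ^ κ) ^ (γ - s)) := by
                rw [ENNReal.ofReal_mul (p := (l * (r n ^ κ) ^ (s - γ)) ^ 2 * (2 * r n ^ κ))
                    (by positivity),
                  ENNReal.ofReal_mul (p := (l * (r n ^ κ) ^ (s - γ)) ^ 2) (by positivity),
                  ENNReal.ofReal_pow (by positivity)]
                ring
            _ = _ := by rw [e, ENNReal.ofReal_mul hp2]; ring
      _ = T * ENNReal.ofReal l := by
          have e2 : ∑ n ∈ S, ENNReal.ofReal (2 * l * l * a n) = ENNReal.ofReal l := by
            rw [← ENNReal.ofReal_sum_of_nonneg fun n _ => by have := hapos n; positivity,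
              ← Finset.mul_sum, ← hA]
            congr 1
            linear_combination l * hlA
          rw [← Finset.mul_sum, e2, hT]
          ring
      _ ≤ ε := le_trans (by gcongr) hl₀ε

end Block

/-! ### Products of independent blocks. -/

section Cascade

variable {Ω : Type*} [MeasurableSpace Ω] {P : Measure Ω} {X : ℕ → Ω → UnitAddCircle}

/-- A bounded random density `M` with mean one, depending on the first `n` points only, such that
the part of the correlation that exceeds one has `s`-energy at most `B`. -/
structure IsCascade (P : Measure Ω) (X : ℕ → Ω → UnitAddCircle) (μ : Measure UnitAddCircle)
    (s : ℝ) (n : ℕ) (M : Ω → UnitAddCircle → ℝ≥0∞) (B : ℝ≥0∞) : Prop where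
  measurable : Measurable (Function.uncurry M)
  adapted : ∀ ξ, Measurable[⨆ i ∈ Iio n, MeasurableSpace.comap (X i) inferInstance] fun ω => M ω ξ
  bounded : ∃ D : ℝ≥0∞, D ≠ ∞ ∧ ∀ ω ξ, M ω ξ ≤ D
  isClosed : ∀ ω, IsClosed {ξ | M ω ξ ≠ 0}
  mean : ∀ ξ, ∫⁻ ω, M ω ξ ∂P = 1
  correlation : ∃ (W : UnitAddCircle → UnitAddCircle → ℝ≥0∞) (C : ℝ≥0∞), C ≠ ∞ ∧
    Measurable (Function.uncurry W) ∧ (∀ ξ η, W ξ η ≤ C) ∧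
    (∀ ξ η, ∫⁻ ω, M ω ξ * M ω η ∂P ≤ 1 + W ξ η) ∧
    ∫⁻ p, W p.1 p.2 * edist p.1 p.2 ^ (-s) ∂(μ.prod μ) ≤ B

theorem IsCascade.mono {μ : Measure UnitAddCircle} {s : ℝ} {n : ℕ}
    {M : Ω → UnitAddCircle → ℝ≥0∞} {B B' : ℝ≥0∞} (h : IsCascade P X μ s n M B) (hB : B ≤ B') :
    IsCascade P X μ s n M B' := by
  refine { h with correlation := ?_ }
  obtain ⟨W, C, h1, h2, h3, h4, h5⟩ := h.correlation
  exact ⟨W, C, h1, h2, h3, h4, h5.trans hB⟩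

theorem isCascade_one [IsProbabilityMeasure P] (μ : Measure UnitAddCircle) (s : ℝ) :
    IsCascade P X μ s 0 (fun _ _ => 1) 0 where
  measurable := measurable_const
  adapted := fun _ => measurable_const
  bounded := ⟨1, by simp, fun _ _ => le_rfl⟩
  isClosed := fun _ => by simp
  mean := fun _ => by simp
  correlation := ⟨fun _ _ => 0, 0, by simp, measurable_const, by simp, by simp, by simp⟩

/-- The new block uses only indices from `n` on, so it is independent of `M` and correlations
multiply: with `V` the block correlation, `(1 + W) * (1 + V) = 1 + W + (1 + W) * V`. The uniform
bound `C` on `W` reduces the added energy to `1 + C` times that of `V`. -/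
theorem IsCascade.mul_blockDensity {μ : Measure UnitAddCircle} [IsFiniteMeasure μ] {s : ℝ} {n : ℕ}
    {M : Ω → UnitAddCircle → ℝ≥0∞} {B : ℝ≥0∞} (h : IsCascade P X μ s n M B)
    (hX : ∀ n, Measurable (X n))
    (hunif : ∀ n, P.map (X n) = (volume : Measure UnitAddCircle)) (hindep : iIndepFun X P)
    {S : Finset ℕ} {w : ℕ → ℝ≥0∞} {δ : ℕ → ℝ} {n' : ℕ} (hS : ∀ i ∈ S, n ≤ i ∧ i < n')
    (hnn' : n ≤ n')
    (hw0 : ∀ i ∈ S, w i ≠ 0) (hw : ∀ i ∈ S, w i ≠ ∞) (hδ : ∀ i ∈ S, δ i ≤ 1 / 2)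
    (hone : ∑ i ∈ S, w i * ENNReal.ofReal (2 * δ i) = 1)
    {C ε : ℝ≥0∞} (hC : C ≠ ∞) {W : UnitAddCircle → UnitAddCircle → ℝ≥0∞}
    (hWm : Measurable (Function.uncurry W)) (hWC : ∀ ξ η, W ξ η ≤ C)
    (hW : ∀ ξ η, ∫⁻ ω, M ω ξ * M ω η ∂P ≤ 1 + W ξ η)
    (hWB : ∫⁻ p, W p.1 p.2 * edist p.1 p.2 ^ (-s) ∂(μ.prod μ) ≤ B)
    (hε : (1 + C) * ∫⁻ p, blockCorrelation S w δ p.1 p.2 * edist p.1 p.2 ^ (-s) ∂(μ.prod μ) ≤ ε) :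
    IsCascade P X μ s n' (fun ω ξ => M ω ξ * blockDensity X S w δ ω ξ) (B + ε) := by
  have hindep' : Indep (⨆ i ∈ Iio n, MeasurableSpace.comap (X i) inferInstance)
      (⨆ i ∈ Ici n, MeasurableSpace.comap (X i) inferInstance) P :=
    indep_iSup_of_disjoint (fun i => (hX i).comap_le) ((iIndepFun_iff_iIndep _ X P).1 hindep)
      (disjoint_left.2 fun i (h1 : i < n) (h2 : n ≤ i) => absurd h1 (not_lt.2 h2))
  have hle : ∀ T : Set ℕ, (⨆ i ∈ T, MeasurableSpace.comap (X i) inferInstance) ≤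
      (inferInstance : MeasurableSpace Ω) := fun T => iSup₂_le fun i _ => (hX i).comap_le
  have hblock : ∀ ξ, Measurable[⨆ i ∈ Ici n, MeasurableSpace.comap (X i) inferInstance]
      fun ω => blockDensity X S w δ ω ξ := fun ξ =>
    measurable_iSup_comap_blockDensity S w δ ξ fun i hi => (hS i hi).1
  have hVm := measurable_blockCorrelation S w δ
  have hwsum : ∑ i ∈ S, w i ≠ ∞ := ENNReal.sum_ne_top.2 hw
  have hWκ : Measurable fun p : UnitAddCircle × UnitAddCircle =>
    W p.1 p.2 * edist p.1 p.2 ^ (-s) := hWm.mul (measurable_edist_rpow (-s))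
  have hVκ : Measurable fun p : UnitAddCircle × UnitAddCircle =>
    blockCorrelation S w δ p.1 p.2 * edist p.1 p.2 ^ (-s) := hVm.mul (measurable_edist_rpow (-s))
  refine ⟨h.measurable.mul (measurable_blockDensity hX S w δ), fun ξ => ?_, ?_, fun ω => ?_,
    fun ξ => ?_, ?_⟩
  · refine ((h.adapted ξ).mono (biSup_mono fun i (hi : i < n) => hi.trans_le hnn') le_rfl).mul ?_
    exact measurable_iSup_comap_blockDensity S w δ ξ fun i hi => (hS i hi).2
  · obtain ⟨D, hD, hMD⟩ := h.bounded
    exact ⟨D * ∑ i ∈ S, w i, ENNReal.mul_ne_top hD hwsum, fun ω ξ =>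
      mul_le_mul' (hMD ω ξ) (blockDensity_le S w δ ω ξ)⟩
  · have : {ξ | M ω ξ * blockDensity X S w δ ω ξ ≠ 0} =
        {ξ | M ω ξ ≠ 0} ∩ {ξ | blockDensity X S w δ ω ξ ≠ 0} := by
      ext ξ; simp
    rw [this]
    exact (h.isClosed ω).inter (isClosed_blockDensity_ne_zero hw0 δ ω)
  · rw [lintegral_mul_eq_lintegral_mul_lintegral_of_independent_measurableSpace (hle _) (hle _)
      hindep' (h.adapted ξ) (hblock ξ), h.mean, one_mul, lintegral_blockDensity hX hunif hδ, hone]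
  · refine ⟨fun ξ η => W ξ η + (1 + W ξ η) * blockCorrelation S w δ ξ η,
      C + (1 + C) * ∑ i ∈ S, w i ^ 2 * ENNReal.ofReal (2 * δ i), ?_, ?_, ?_, ?_, ?_⟩
    · refine ENNReal.add_ne_top.2 ⟨hC, ENNReal.mul_ne_top (ENNReal.add_ne_top.2 ⟨by simp, hC⟩) ?_⟩
      exact ENNReal.sum_ne_top.2 fun i hi =>
        ENNReal.mul_ne_top (ENNReal.pow_ne_top (hw i hi)) ENNReal.ofReal_ne_top
    · exact hWm.add ((measurable_const.add hWm).mul hVm)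
    · intro ξ η
      exact add_le_add (hWC ξ η)
        (mul_le_mul' (add_le_add le_rfl (hWC ξ η)) (blockCorrelation_le S w δ ξ η))
    · intro ξ η
      calc ∫⁻ ω, M ω ξ * blockDensity X S w δ ω ξ * (M ω η * blockDensity X S w δ ω η) ∂P
          = ∫⁻ ω, (M ω ξ * M ω η) *
              (blockDensity X S w δ ω ξ * blockDensity X S w δ ω η) ∂P := by
            refine lintegral_congr fun ω => ?_
            ring
        _ = (∫⁻ ω, M ω ξ * M ω η ∂P) *
              ∫⁻ ω, blockDensity X S w δ ω ξ * blockDensity X S w δ ω η ∂P :=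
            lintegral_mul_eq_lintegral_mul_lintegral_of_independent_measurableSpace (hle _) (hle _)
              hindep' ((h.adapted ξ).mul (h.adapted η)) ((hblock ξ).mul (hblock η))
        _ ≤ (1 + W ξ η) * (1 + blockCorrelation S w δ ξ η) :=
            mul_le_mul' (hW ξ η) (lintegral_blockDensity_mul_le hX hunif hindep hδ hone ξ η)
        _ = _ := by ring
    · calc ∫⁻ p, (W p.1 p.2 + (1 + W p.1 p.2) * blockCorrelation S w δ p.1 p.2) *
            edist p.1 p.2 ^ (-s) ∂(μ.prod μ)
          ≤ ∫⁻ p, W p.1 p.2 * edist p.1 p.2 ^ (-s) +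
              (1 + C) * (blockCorrelation S w δ p.1 p.2 * edist p.1 p.2 ^ (-s)) ∂(μ.prod μ) := by
            refine lintegral_mono fun p => ?_
            rw [add_mul, mul_assoc (1 + W p.1 p.2)]
            have h1 := hWC p.1 p.2
            gcongr
        _ = ∫⁻ p, W p.1 p.2 * edist p.1 p.2 ^ (-s) ∂(μ.prod μ) + (1 + C) *
              ∫⁻ p, blockCorrelation S w δ p.1 p.2 * edist p.1 p.2 ^ (-s) ∂(μ.prod μ) := by
            rw [lintegral_add_left hWκ, lintegral_const_mul _ hVκ]
        _ ≤ B + ε := add_le_add hWB hε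

theorem IsCascade.exists_next {r : ℕ → ℝ} (hr : ∀ n, 0 < r n)
    (hr0 : Tendsto r atTop (nhds 0)) {G : Set UnitAddCircle} {γ s : ℝ}
    {μ : Measure UnitAddCircle} [IsFiniteMeasure μ] (hGμ : μ Gᶜ = 0) {K : ℝ≥0∞} (hKtop : K ≠ ∞)
    (hK : ∀ x ∈ G, ∀ u : ℝ, 0 < u →
      ∫⁻ y in Metric.closedBall x u, edist x y ^ (-s) ∂μ ≤ K * ENNReal.ofReal (u ^ (γ - s)))
    {κ : ℝ} (hκ : 0 < κ) (hdiv : ¬ Summable fun n => r n ^ (κ * (1 + s - γ)))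
    {n : ℕ} {M : Ω → UnitAddCircle → ℝ≥0∞} {B : ℝ≥0∞} (h : IsCascade P X μ s n M B)
    (hX : ∀ n, Measurable (X n))
    (hunif : ∀ n, P.map (X n) = (volume : Measure UnitAddCircle)) (hindep : iIndepFun X P)
    {ε : ℝ≥0∞} (hε : ε ≠ 0) :
    ∃ (n' : ℕ) (M' : Ω → UnitAddCircle → ℝ≥0∞), IsCascade P X μ s n' M' (B + ε) ∧ n < n' ∧
      ∀ ω ξ, M' ω ξ ≠ 0 → M ω ξ ≠ 0 ∧ ∃ i, n ≤ i ∧ dist ξ (X i ω) ≤ r i ^ κ := by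
  obtain ⟨W, C, hC, hWm, hWC, hW, hWB⟩ := h.correlation
  have hC1 : 1 + C ≠ ∞ := ENNReal.add_ne_top.2 ⟨by simp, hC⟩
  -- The block is chosen after `C` is known, so `C` need not stay bounded along the construction.
  obtain ⟨S, w, hS, hw0, hw, hδ, hone, henergy⟩ :=
    exists_block_of_not_summable hr hr0 μ hGμ hKtop hK hκ hdiv n (ε := ε / (1 + C))
      (ENNReal.div_ne_zero.2 ⟨hε, hC1⟩)
  refine ⟨max (n + 1) (S.sup id + 1), _, h.mul_blockDensity hX hunif hindep
    (fun i hi => ⟨hS i hi, ?_⟩) ?_ hw0 hw hδ hone hC hWm hWC hW hWB ?_, ?_, ?_⟩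
  · exact lt_max_of_lt_right (Nat.lt_succ_of_le (Finset.le_sup (f := id) hi))
  · exact (Nat.le_succ n).trans (le_max_left _ _)
  · have hm : Measurable fun p : UnitAddCircle × UnitAddCircle =>
        blockCorrelation S w (fun n => r n ^ κ) p.1 p.2 * edist p.1 p.2 ^ (-s) :=
      (measurable_blockCorrelation S w _).mul (measurable_edist_rpow (-s))
    rw [lintegral_prod _ hm.aemeasurable]
    calc (1 + C) * _ ≤ (1 + C) * (ε / (1 + C)) := mul_le_mul_right henergy _
      _ ≤ ε := ENNReal.mul_div_le
  · exact (Nat.lt_succ_self n).trans_le (le_max_left _ _)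
  · intro ω ξ hne
    obtain ⟨h1, h2⟩ := mul_ne_zero_iff.1 hne
    obtain ⟨i, hi, hdist⟩ := (blockDensity_ne_zero_iff hw0).1 h2
    exact ⟨h1, i, hS i hi, hdist⟩

theorem exists_seq_of_forall_exists_next {σ : Type*} {Q : ℕ → σ → Prop} {R : ℕ → σ → σ → Prop}
    (h0 : ∃ x, Q 0 x) (hstep : ∀ k x, Q k x → ∃ y, Q (k + 1) y ∧ R k x y) :
    ∃ f : ℕ → σ, ∀ k, Q k (f k) ∧ R k (f k) (f (k + 1)) := by
  choose! g hgQ hgR using hstep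
  obtain ⟨x, hx⟩ := h0
  set f : ℕ → σ := fun k => Nat.rec x g k with hf
  have hQ : ∀ k, Q k (f k) := by
    intro k
    induction k with
    | zero => exact hx
    | succ k ih => exact hgQ k _ ih
  exact ⟨f, fun k => ⟨hQ k, hgR k _ (hQ k)⟩⟩

theorem exists_cascade_seq [IsProbabilityMeasure P] {r : ℕ → ℝ} (hr : ∀ n, 0 < r n)
    (hr0 : Tendsto r atTop (nhds 0)) {G : Set UnitAddCircle} {γ s : ℝ}
    {μ : Measure UnitAddCircle} [IsFiniteMeasure μ] (hGμ : μ Gᶜ = 0) {K : ℝ≥0∞} (hKtop : K ≠ ∞)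
    (hK : ∀ x ∈ G, ∀ u : ℝ, 0 < u →
      ∫⁻ y in Metric.closedBall x u, edist x y ^ (-s) ∂μ ≤ K * ENNReal.ofReal (u ^ (γ - s)))
    {κ : ℕ → ℝ} (hκ : ∀ k, 0 < κ k) (hdiv : ∀ k, ¬ Summable fun n => r n ^ (κ k * (1 + s - γ)))
    (hX : ∀ n, Measurable (X n))
    (hunif : ∀ n, P.map (X n) = (volume : Measure UnitAddCircle)) (hindep : iIndepFun X P)
    {ε : ℝ≥0∞} (hε : ε ≠ 0) :
    ∃ (N : ℕ → ℕ) (M : ℕ → Ω → UnitAddCircle → ℝ≥0∞), ∀ k, IsCascade P X μ s (N k) (M k) ε ∧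
      N k < N (k + 1) ∧ ∀ ω ξ, M (k + 1) ω ξ ≠ 0 → M k ω ξ ≠ 0 ∧
        ∃ i, N k ≤ i ∧ dist ξ (X i ω) ≤ r i ^ κ k := by
  obtain ⟨e, he0, hesum⟩ := ENNReal.exists_pos_sum_of_countable hε ℕ
  obtain ⟨f, hf⟩ := exists_seq_of_forall_exists_next
    (Q := fun k (x : ℕ × (Ω → UnitAddCircle → ℝ≥0∞)) =>
      IsCascade P X μ s x.1 x.2 (∑ i ∈ Finset.range k, (e i : ℝ≥0∞)))
    (R := fun k x y => x.1 < y.1 ∧ ∀ ω ξ, y.2 ω ξ ≠ 0 → x.2 ω ξ ≠ 0 ∧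
        ∃ i, x.1 ≤ i ∧ dist ξ (X i ω) ≤ r i ^ κ k)
    ⟨(0, fun _ _ => 1), by simpa using isCascade_one μ s⟩ (by
      rintro k ⟨n, M⟩ h
      obtain ⟨n', M', h1, h2, h3⟩ := h.exists_next hr hr0 hGμ hKtop hK (hκ k) (hdiv k) hX hunif
        hindep (ε := e k) (by simpa using (he0 k).ne')
      refine ⟨(n', M'), ?_, h2, h3⟩
      rwa [Finset.sum_range_succ])
  refine ⟨fun k => (f k).1, fun k => (f k).2, fun k => ⟨(hf k).1.mono ?_, (hf k).2⟩⟩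
  exact (ENNReal.sum_le_tsum _).trans hesum.le

end Cascade

/-! ### Moments of the mass and mean of the energy. -/

section SecondMoment

variable {Ω : Type*} [MeasurableSpace Ω] {P : Measure Ω} {X : ℕ → Ω → UnitAddCircle}

/-- The circle has diameter at most `1 / 2`. Thus the energy budget for the correlations also
controls the variance of the mass. -/
theorem one_le_edist_rpow_neg {s : ℝ} (hs : 0 ≤ s) (x y : UnitAddCircle) :
    1 ≤ edist x y ^ (-s) := by
  rw [ENNReal.rpow_neg, ENNReal.one_le_inv]
  refine ENNReal.rpow_le_one ?_ hs
  rw [edist_dist, ENNReal.ofReal_le_one, dist_eq_norm]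
  have := AddCircle.norm_le_half_period (1 : ℝ) (x := x - y) one_ne_zero
  rw [abs_one] at this
  linarith

theorem measurable_rieszKernel_mul {s : ℝ} {f : UnitAddCircle → ℝ≥0∞} (hf : Measurable f) :
    Measurable fun p : UnitAddCircle × UnitAddCircle =>
      edist p.1 p.2 ^ (-s) * (f p.1 * f p.2) :=
  (measurable_edist_rpow (-s)).mul ((hf.comp measurable_fst).mul (hf.comp measurable_snd))

theorem rieszEnergy_withDensity {s : ℝ} {μ : Measure UnitAddCircle} [IsFiniteMeasure μ]
    {f : UnitAddCircle → ℝ≥0∞} (hf : Measurable f) :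
    rieszEnergy s (μ.withDensity f) =
      ∫⁻ p, edist p.1 p.2 ^ (-s) * (f p.1 * f p.2) ∂(μ.prod μ) := by
  have hk : ∀ x : UnitAddCircle, Measurable fun y => edist x y ^ (-s) := fun x =>
    (measurable_const.edist measurable_id).pow_const (-s)
  have hin : ∀ x : UnitAddCircle, ∫⁻ y, edist x y ^ (-s) ∂(μ.withDensity f) =
      ∫⁻ y, f y * edist x y ^ (-s) ∂μ := fun x => by
    rw [lintegral_withDensity_eq_lintegral_mul _ hf (hk x)]
    rfl
  have hm : Measurable fun p : UnitAddCircle × UnitAddCircle =>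
      f p.2 * edist p.1 p.2 ^ (-s) := (hf.comp measurable_snd).mul (measurable_edist_rpow (-s))
  have hout : Measurable fun x : UnitAddCircle => ∫⁻ y, f y * edist x y ^ (-s) ∂μ :=
    hm.lintegral_prod_right'
  unfold rieszEnergy
  simp only [hin]
  rw [lintegral_withDensity_eq_lintegral_mul _ hf hout,
    lintegral_prod _ (measurable_rieszKernel_mul hf).aemeasurable]
  refine lintegral_congr fun x => ?_
  have hm' : Measurable fun y => f y * edist x y ^ (-s) := hf.mul (hk x)
  simp only [Pi.mul_apply]
  rw [← lintegral_const_mul _ hm']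
  refine lintegral_congr fun y => ?_
  ring

namespace IsCascade

variable {μ : Measure UnitAddCircle} {s : ℝ} {n : ℕ} {M : Ω → UnitAddCircle → ℝ≥0∞}
  {B : ℝ≥0∞}

theorem measurable_apply (h : IsCascade P X μ s n M B) (ω : Ω) : Measurable (M ω) :=
  h.measurable.comp measurable_prodMk_left

theorem measurable_uncurry_mul (h : IsCascade P X μ s n M B)
    {g : UnitAddCircle × UnitAddCircle → ℝ≥0∞} (hg : Measurable g) :
    Measurable (Function.uncurry fun (ω : Ω) (p : UnitAddCircle × UnitAddCircle) =>
      g p * (M ω p.1 * M ω p.2)) := by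
  have h1 : Measurable fun q : Ω × (UnitAddCircle × UnitAddCircle) => M q.1 q.2.1 :=
    h.measurable.comp (measurable_fst.prodMk (measurable_fst.comp measurable_snd))
  have h2 : Measurable fun q : Ω × (UnitAddCircle × UnitAddCircle) => M q.1 q.2.2 :=
    h.measurable.comp (measurable_fst.prodMk (measurable_snd.comp measurable_snd))
  exact (hg.comp measurable_snd).mul (h1.mul h2)

variable [IsFiniteMeasure μ]

/-- Used twice: with `g` the Riesz kernel for the mean energy, and with `g = 1` for the second
moment of the mass. -/
theorem lintegral_lintegral_mul_le [SFinite P] (h : IsCascade P X μ s n M B)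
    {g : UnitAddCircle × UnitAddCircle → ℝ≥0∞} (hg : Measurable g)
    (hgle : ∀ p, g p ≤ edist p.1 p.2 ^ (-s)) :
    ∫⁻ ω, ∫⁻ p, g p * (M ω p.1 * M ω p.2) ∂(μ.prod μ) ∂P ≤ ∫⁻ p, g p ∂(μ.prod μ) + B := by
  obtain ⟨W, C, -, -, -, hW, hWB⟩ := h.correlation
  have hM : ∀ ξ, Measurable fun ω => M ω ξ := fun ξ =>
    h.measurable.comp (measurable_id.prodMk measurable_const)
  rw [lintegral_lintegral_swap (h.measurable_uncurry_mul hg).aemeasurable]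
  calc ∫⁻ p, ∫⁻ ω, g p * (M ω p.1 * M ω p.2) ∂P ∂(μ.prod μ)
      ≤ ∫⁻ p, g p + W p.1 p.2 * edist p.1 p.2 ^ (-s) ∂(μ.prod μ) := by
        refine lintegral_mono fun p => ?_
        have hMM : Measurable fun ω => M ω p.1 * M ω p.2 := (hM p.1).mul (hM p.2)
        rw [lintegral_const_mul _ hMM]
        calc g p * ∫⁻ ω, M ω p.1 * M ω p.2 ∂P ≤ g p * (1 + W p.1 p.2) :=
              mul_le_mul_right (hW _ _) _
          _ = g p + W p.1 p.2 * g p := by ring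
          _ ≤ _ := add_le_add le_rfl (mul_le_mul_right (hgle p) _)
    _ = ∫⁻ p, g p ∂(μ.prod μ) + ∫⁻ p, W p.1 p.2 * edist p.1 p.2 ^ (-s) ∂(μ.prod μ) :=
        lintegral_add_left hg _
    _ ≤ _ := add_le_add le_rfl hWB

theorem measurable_rieszEnergy (h : IsCascade P X μ s n M B) :
    Measurable fun ω => rieszEnergy s (μ.withDensity (M ω)) := by
  simp only [fun ω => rieszEnergy_withDensity (s := s) (μ := μ) (h.measurable_apply ω)]
  exact (h.measurable_uncurry_mul (measurable_edist_rpow (-s))).lintegral_prod_right'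

theorem lintegral_rieszEnergy_le [SFinite P] (h : IsCascade P X μ s n M B) :
    ∫⁻ ω, rieszEnergy s (μ.withDensity (M ω)) ∂P ≤ rieszEnergy s μ + B := by
  simp only [fun ω => rieszEnergy_withDensity (s := s) (μ := μ) (h.measurable_apply ω)]
  refine (h.lintegral_lintegral_mul_le (measurable_edist_rpow (-s)) fun _ => le_rfl).trans_eq ?_
  rw [lintegral_prod _ (measurable_edist_rpow (-s)).aemeasurable]
  rfl

theorem measurable_mass (h : IsCascade P X μ s n M B) : Measurable fun ω => ∫⁻ ξ, M ω ξ ∂μ :=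
  h.measurable.lintegral_prod_right'

theorem lintegral_mass [SFinite P] (h : IsCascade P X μ s n M B) :
    ∫⁻ ω, ∫⁻ ξ, M ω ξ ∂μ ∂P = μ univ := by
  rw [lintegral_lintegral_swap h.measurable.aemeasurable]
  simp [h.mean]

theorem lintegral_mass_sq_le [SFinite P] (h : IsCascade P X μ s n M B) (hs : 0 ≤ s) :
    ∫⁻ ω, (∫⁻ ξ, M ω ξ ∂μ) ^ 2 ∂P ≤ μ univ ^ 2 + B := by
  have heq : ∀ ω, (∫⁻ ξ, M ω ξ ∂μ) ^ 2 = ∫⁻ p, 1 * (M ω p.1 * M ω p.2) ∂(μ.prod μ) := by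
    intro ω
    simp only [one_mul]
    rw [sq, lintegral_prod_mul (h.measurable_apply ω).aemeasurable
      (h.measurable_apply ω).aemeasurable]
  simp only [heq]
  refine (h.lintegral_lintegral_mul_le (g := fun _ => 1) measurable_const
    fun p => one_le_edist_rpow_neg hs p.1 p.2).trans_eq ?_
  rw [lintegral_one, ← univ_prod_univ, Measure.prod_prod, sq]

theorem lintegral_ne_top (h : IsCascade P X μ s n M B) (ω : Ω) : ∫⁻ ξ, M ω ξ ∂μ ≠ ∞ := by
  obtain ⟨D, hD, hMD⟩ := h.bounded
  refine ne_of_lt (lt_of_le_of_lt (lintegral_mono (hMD ω)) ?_)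
  rw [lintegral_const]
  exact ENNReal.mul_lt_top hD.lt_top (measure_lt_top _ _)

end IsCascade

/-- A second moment bound for the lower deviations of a nonnegative function with mean `2 * a`. -/
theorem sq_mul_measure_lt_le [IsProbabilityMeasure P] {Z : Ω → ℝ≥0∞} (hZ : Measurable Z)
    {a B : ℝ≥0∞} (ha : a ≠ ∞) (h1 : ∫⁻ ω, Z ω ∂P = 2 * a)
    (h2 : ∫⁻ ω, Z ω ^ 2 ∂P ≤ (2 * a) ^ 2 + B) : a ^ 2 * P {ω | Z ω < a} ≤ B := by
  have hset : MeasurableSet {ω | Z ω < a} := measurableSet_lt hZ measurable_const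
  -- This is `a ^ 2 ≤ (Z - 2 * a) ^ 2` on `Z < a`, and `0 ≤ (Z - 2 * a) ^ 2` elsewhere, expanded so
  -- that no subtraction occurs in `ℝ≥0∞`.
  have hpt : ∀ ω, {ω | Z ω < a}.indicator (fun _ => a ^ 2) ω + 4 * a * Z ω ≤
      Z ω ^ 2 + 4 * a ^ 2 := by
    intro ω
    generalize hz : Z ω = z
    rcases eq_or_ne z ∞ with rfl | hzt
    · simp
    lift z to ℝ≥0 using hzt
    lift a to ℝ≥0 using ha
    by_cases h : Z ω < a
    · rw [indicator_of_mem (show ω ∈ {ω | Z ω < a} from h)]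
      rw [hz, ENNReal.coe_lt_coe] at h
      have : a ^ 2 + 4 * a * z ≤ z ^ 2 + 4 * a ^ 2 := by
        rw [← NNReal.coe_le_coe]
        have h' : (z : ℝ) < a := by exact_mod_cast h
        push_cast
        nlinarith [NNReal.coe_nonneg a, NNReal.coe_nonneg z]
      exact_mod_cast this
    · rw [indicator_of_notMem (show ω ∉ {ω | Z ω < a} from h), zero_add]
      have : 4 * a * z ≤ z ^ 2 + 4 * a ^ 2 := by
        rw [← NNReal.coe_le_coe]
        push_cast
        nlinarith [sq_nonneg ((z : ℝ) - 2 * a)]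
      exact_mod_cast this
  have hint := lintegral_mono (μ := P) hpt
  rw [lintegral_add_right _ (hZ.const_mul _), lintegral_indicator_const hset,
    lintegral_const_mul _ hZ, h1, lintegral_add_right _ measurable_const, lintegral_const,
    measure_univ, mul_one] at hint
  have htop : 8 * a ^ 2 ≠ ∞ := ENNReal.mul_ne_top (by simp) (ENNReal.pow_ne_top ha)
  refine (ENNReal.add_le_add_iff_right htop).1 ?_
  calc a ^ 2 * P {ω | Z ω < a} + 8 * a ^ 2
      = a ^ 2 * P {ω | Z ω < a} + 4 * a * (2 * a) := by ring
    _ ≤ (2 * a) ^ 2 + B + 4 * a ^ 2 := hint.trans (add_le_add h2 le_rfl)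
    _ = B + 8 * a ^ 2 := by ring

theorem measure_eventually_le {A : ℕ → Set Ω} {ε : ℝ≥0∞} (h : ∀ k, P (A k) ≤ ε) :
    P {ω | ∀ᶠ k in atTop, ω ∈ A k} ≤ ε := by
  have heq : {ω | ∀ᶠ k in atTop, ω ∈ A k} = ⋃ N, ⋂ k ≥ N, A k := by
    ext ω; simp [eventually_atTop]
  have hmono : Monotone fun N => ⋂ k ≥ N, A k := fun N N' hN =>
    biInter_subset_biInter_left fun k (hk : N' ≤ k) => hN.trans hk
  rw [heq, hmono.measure_iUnion]
  exact iSup_le fun N => (measure_mono (biInter_subset_of_mem (le_refl N))).trans (h N)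

end SecondMoment

/-! ### Lower bound for the dimension. -/

section LowerBound

variable {Ω : Type*} [MeasurableSpace Ω] {P : Measure Ω} [IsProbabilityMeasure P]
  {X : ℕ → Ω → UnitAddCircle}

theorem rieszEnergy_ne_top {G : Set UnitAddCircle} {γ s : ℝ} {μ : Measure UnitAddCircle}
    [IsFiniteMeasure μ] (hGμ : μ Gᶜ = 0) {K : ℝ≥0∞} (hKtop : K ≠ ∞)
    (hK : ∀ x ∈ G, ∀ u : ℝ, 0 < u →
      ∫⁻ y in Metric.closedBall x u, edist x y ^ (-s) ∂μ ≤ K * ENNReal.ofReal (u ^ (γ - s))) :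
    rieszEnergy s μ ≠ ∞ := by
  have hae : ∀ᵐ x ∂μ, x ∈ G := by rw [ae_iff]; exact hGμ
  have hle : ∀ x ∈ G, ∫⁻ y, edist x y ^ (-s) ∂μ ≤ K := by
    intro x hx
    have huniv : Metric.closedBall x 1 = univ := by
      refine eq_univ_of_forall fun y => ?_
      rw [Metric.mem_closedBall, dist_eq_norm]
      have := AddCircle.norm_le_half_period (1 : ℝ) (x := y - x) one_ne_zero
      rw [abs_one] at this
      linarith
    have := hK x hx 1 one_pos
    rwa [huniv, Measure.restrict_univ, Real.one_rpow, ENNReal.ofReal_one, mul_one] at this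
  refine ne_of_lt (lt_of_le_of_lt (lintegral_mono_ae (hae.mono hle)) ?_)
  rw [lintegral_const]
  exact ENNReal.mul_lt_top hKtop.lt_top (measure_lt_top _ _)

theorem ofReal_le_approxExponent_of_strictMono {x : ℕ → UnitAddCircle} {r : ℕ → ℝ}
    (hr : ∀ n, 0 < r n)
    (hr0 : Tendsto r atTop (nhds 0)) {ν : ℝ} {κ : ℕ → ℝ} (hκ : Tendsto κ atTop (nhds ν))
    {N : ℕ → ℕ} (hN : StrictMono N) {ξ : UnitAddCircle}
    (h : ∀ k, ∃ i, N k ≤ i ∧ dist ξ (x i) ≤ r i ^ κ k) :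
    ENNReal.ofReal ν ≤ approxExponent x r ξ := by
  refine ofReal_le_approxExponent fun κ₀ _ hκ₀ => frequently_atTop.2 fun n₀ => ?_
  obtain ⟨n₁, hn₁⟩ := eventually_atTop.1 (hr0.eventually (Iio_mem_nhds one_pos))
  obtain ⟨k, hk1, hk2⟩ :=
    ((hκ.eventually (Ioi_mem_nhds hκ₀)).and (eventually_ge_atTop (max n₀ n₁))).exists
  obtain ⟨i, hi, hdist⟩ := h k
  have hi' : max n₀ n₁ ≤ i := hk2.trans ((hN.id_le k).trans hi)
  refine ⟨i, (le_max_left _ _).trans hi', hdist.trans_lt ?_⟩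
  -- The gap `κ₀ < κ k` turns the closed arcs of the construction into the open arcs of `limsupSet`,
  -- once `r i < 1`.
  exact Real.rpow_lt_rpow_of_exponent_gt (hr i) (hn₁ i ((le_max_right _ _).trans hi')) hk1

theorem ae_le_dimH_approxExponent (hX : ∀ n, Measurable (X n))
    (hunif : ∀ n, P.map (X n) = (volume : Measure UnitAddCircle)) (hindep : iIndepFun X P)
    {r : ℕ → ℝ} (hr : ∀ n, 0 < r n) (hr0 : Tendsto r atTop (nhds 0))
    {G : Set UnitAddCircle} (hne : G.Nonempty) {γ : ℝ} (hG : IsAhlforsRegular G γ)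
    {s : ℝ≥0} (hsγ : s < γ) {ν : ℝ} (hν : 0 < ν)
    (hdiv : ∀ κ, 0 < κ → κ < ν → ¬ Summable fun n => r n ^ (κ * (1 + s - γ))) :
    ∀ᵐ ω ∂P, {ξ ∈ G | ENNReal.ofReal ν ≤ approxExponent (fun n => X n ω) r ξ}.Nonempty ∧
      (s : ℝ≥0∞) ≤ dimH {ξ ∈ G | ENNReal.ofReal ν ≤ approxExponent (fun n => X n ω) r ξ} := by
  obtain ⟨μ, hμfin, hGμ, hμ0, c, hc, -, hupp⟩ := hG.exists_measure hne
  obtain ⟨K, hKtop, hK⟩ := lintegral_edist_rpow_neg_le s.2 hsγ μ hc hupp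
  have hI := rieszEnergy_ne_top hGμ hKtop hK
  obtain ⟨κ, -, hκ, hκlim⟩ := exists_seq_strictMono_tendsto' hν
  rw [ae_iff]
  refine le_antisymm (ENNReal.le_of_forall_pos_le_add fun ε' hε' _ => ?_) bot_le
  rw [zero_add]
  set ε : ℝ≥0∞ := ENNReal.ofNNReal ε' with hεdef
  have hε : ε ≠ 0 := by simpa [hεdef] using hε'.ne'
  have hε2 : ε / 2 ≠ 0 := (ENNReal.half_pos hε).ne'
  have hε2top : ε / 2 ≠ ∞ := ENNReal.div_ne_top (by simp [hεdef]) (by simp)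
  set a : ℝ≥0∞ := μ univ / 2 with ha
  have ha0 : a ≠ 0 := (ENNReal.half_pos hμ0).ne'
  have hatop : a ≠ ∞ := ENNReal.div_ne_top (measure_ne_top _ _) (by simp)
  have h2a : 2 * a = μ univ := ENNReal.mul_div_cancel (by simp) (by simp)
  have ha2 : a ^ 2 ≠ 0 := pow_ne_zero 2 ha0
  have ha2top : a ^ 2 ≠ ∞ := ENNReal.pow_ne_top hatop
  -- With this budget Chebyshev gives probability at most `ε / 2` to a mass below half its mean.
  set B : ℝ≥0∞ := a ^ 2 * (ε / 2) with hB
  have hBtop : B ≠ ∞ := ENNReal.mul_ne_top ha2top hε2top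
  obtain ⟨N, M, hM⟩ := exists_cascade_seq (P := P) (X := X) hr hr0 hGμ hKtop hK
    (fun k => (hκ k).1) (fun k => hdiv (κ k) (hκ k).1 (hκ k).2) hX hunif hindep
    (ε := B) (mul_ne_zero ha2 hε2)
  -- Threshold for which Markov gives `ε / 2`; the added `1` keeps it nonzero.
  set A : ℝ≥0∞ := (rieszEnergy s μ + B + 1) / (ε / 2) with hA
  have hA0 : A ≠ 0 := ENNReal.div_ne_zero.2 ⟨by simp, hε2top⟩
  have hAtop : A ≠ ∞ := ENNReal.div_ne_top
    (ENNReal.add_ne_top.2 ⟨ENNReal.add_ne_top.2 ⟨hI, hBtop⟩, by simp⟩) hε2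
  have hbad : ∀ k, P ({ω | ∫⁻ ξ, M k ω ξ ∂μ < a} ∪
      {ω | A ≤ rieszEnergy s (μ.withDensity (M k ω))}) ≤ ε := by
    intro k
    have hk := (hM k).1
    refine (measure_union_le _ _).trans ?_
    rw [← ENNReal.add_halves ε]
    refine add_le_add ?_ ?_
    · have := sq_mul_measure_lt_le hk.measurable_mass hatop (hk.lintegral_mass.trans h2a.symm)
        (B := B) (by rw [h2a]; exact hk.lintegral_mass_sq_le s.2)
      exact (ENNReal.mul_le_mul_iff_right ha2 ha2top).1 this
    · refine (meas_ge_le_lintegral_div hk.measurable_rieszEnergy.aemeasurable hA0 hAtop).trans ?_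
      refine ENNReal.div_le_of_le_mul (hk.lintegral_rieszEnergy_le.trans ?_)
      rw [hA, ENNReal.mul_div_cancel hε2 hε2top]
      exact le_self_add
  -- A failing `ω` must be bad for all large `k`, since good stages at infinitely many `k` suffice
  -- for the conclusion.
  refine (measure_mono ?_).trans (measure_eventually_le hbad)
  intro ω hω
  by_contra hcon
  refine hω ?_
  have hfreq : ∃ᶠ k in atTop, a ≤ μ.withDensity (M k ω) univ ∧
      rieszEnergy s (μ.withDensity (M k ω)) ≤ A := by
    refine Frequently.mono (not_eventually.1 hcon) fun k hk => ?_
    simp only [mem_union, mem_ofPred_eq, not_or, not_lt, not_le] at hk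
    rw [withDensity_apply _ MeasurableSet.univ, Measure.restrict_univ]
    exact ⟨hk.1, hk.2.le⟩
  have hfin : ∀ k, IsFiniteMeasure (μ.withDensity (M k ω)) := fun k =>
    isFiniteMeasure_withDensity ((hM k).1.lintegral_ne_top ω)
  have hsub : (⋂ k, G ∩ {ξ | M k ω ξ ≠ 0}) ⊆
      {ξ ∈ G | ENNReal.ofReal ν ≤ approxExponent (fun n => X n ω) r ξ} := by
    intro ξ hξ
    have hξ' := mem_iInter.1 hξ
    exact ⟨(hξ' 0).1, ofReal_le_approxExponent_of_strictMono hr hr0 hκlim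
      (strictMono_nat_of_lt_succ fun k => (hM k).2.1)
      fun k => ((hM k).2.2 ω ξ (hξ' (k + 1)).2).2⟩
  have hsupp : ∀ k, μ.withDensity (M k ω) (G ∩ {ξ | M k ω ξ ≠ 0})ᶜ = 0 := fun k => by
    rw [withDensity_apply_eq_zero ((hM k).1.measurable_apply ω)]
    refine measure_mono_null ?_ hGμ
    rintro ξ ⟨h3, h4⟩ hξ
    exact h4 ⟨hξ, h3⟩
  obtain ⟨h1, h2⟩ := le_dimH_iInter_of_rieszEnergy_le (s := s) (K := fun k => G ∩ {ξ | M k ω ξ ≠ 0})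
    (fun k => hG.isCompact.inter_right ((hM k).1.isClosed ω))
    (antitone_nat_of_succ_le fun k ξ hξ => ⟨hξ.1, ((hM k).2.2 ω ξ hξ.2).1⟩)
    (fun k => μ.withDensity (M k ω)) hsupp ha0 hAtop hfreq
  exact ⟨h1.mono hsub, h2.trans (dimH_mono hsub)⟩

end LowerBound

/-! ### Assembly of the bounds. -/

theorem mainTheorem10 {Ω : Type*} [MeasurableSpace Ω] (P : Measure Ω) [IsProbabilityMeasure P]
    (X : ℕ → Ω → UnitAddCircle) (hX : ∀ n, Measurable (X n))
    (hunif : ∀ n, P.map (X n) = (volume : Measure UnitAddCircle)) (hindep : iIndepFun X P)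
    (r : ℕ → ℝ) (hr : ∀ n, 0 < r n ∧ r n ≤ 1) (ρ : ℝ) (hρ : 0 < ρ)
    (hdiv : ∀ ν : ℝ, ν < ρ → ¬ Summable (fun n => r n ^ ν))
    (hconv : ∀ ν : ℝ, ρ < ν → Summable (fun n => r n ^ ν))
    (G : Set UnitAddCircle) (hne : G.Nonempty) (γ : ℝ) (hG : IsAhlforsRegular G γ) :
    (∀ᵐ ω ∂P, ∀ ξ ∈ G,
      ENNReal.ofReal ρ ≤ approxExponent (fun n => X n ω) r ξ ∧
      approxExponent (fun n => X n ω) r ξ ≤ ENNReal.ofReal ρ / ENNReal.ofReal (1 - γ)) ∧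
    (∀ ν : ℝ, ρ ≤ ν → (1 - γ) * ν ≤ ρ →
      ∀ᵐ ω ∂P,
        hausdorffDim {ξ ∈ G | ENNReal.ofReal ν ≤ approxExponent (fun n => X n ω) r ξ} =
          ((ρ / ν + γ - 1 : ℝ) : EReal)) := by
  refine ⟨?_, fun ν hρν hνγ => ?_⟩
  · filter_upwards [ae_ofReal_le_approxExponent hX hunif hindep hr hρ hdiv,
      ae_approxExponent_le hX hunif hr hρ hconv hne hG] with ω h1 h2 ξ hξ
    exact ⟨h1 ξ, h2 ξ hξ⟩
  have hν : 0 < ν := hρ.trans_le hρν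
  have hγ := hG.dim_pos
  have hr0 : Tendsto r atTop (nhds 0) := by
    have h1 := (hconv (ρ + 1) (by linarith)).tendsto_atTop_zero
    have hpos : 0 < ρ + 1 := by linarith
    have h2 := (Real.continuousAt_rpow_const 0 (ρ + 1)⁻¹ (Or.inr (by positivity))).tendsto.comp h1
    rw [Real.zero_rpow (inv_ne_zero hpos.ne')] at h2
    refine h2.congr fun n => ?_
    simp only [Function.comp_apply]
    exact Real.rpow_rpow_inv (hr n).1.le hpos.ne'
  set s₀ : ℝ := ρ / ν + γ - 1 with hs₀
  have hs₀nonneg : 0 ≤ s₀ := by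
    have : 1 - γ ≤ ρ / ν := (le_div_iff₀ hν).2 hνγ
    linarith
  have hs₀γ : s₀ ≤ γ := by
    have : ρ / ν ≤ 1 := (div_le_one hν).2 hρν
    linarith
  have hlower : ∀ s : ℝ≥0, (s : ℝ) < γ → (s : ℝ) ≤ s₀ → ∀ᵐ ω ∂P,
      {ξ ∈ G | ENNReal.ofReal ν ≤ approxExponent (fun n => X n ω) r ξ}.Nonempty ∧
      (s : ℝ≥0∞) ≤ dimH {ξ ∈ G | ENNReal.ofReal ν ≤ approxExponent (fun n => X n ω) r ξ} := by
    intro s hsγ hs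
    refine ae_le_dimH_approxExponent hX hunif hindep (fun n => (hr n).1) hr0 hne hG hsγ hν
      fun κ hκ hκν => hdiv _ ?_
    calc κ * (1 + s - γ) ≤ κ * (ρ / ν) := by gcongr; linarith
      _ < ν * (ρ / ν) := by gcongr
      _ = ρ := by field_simp
  obtain ⟨u, hu, hulim⟩ : ∃ u : ℕ → ℝ≥0, (∀ k, (u k : ℝ) < γ ∧ (u k : ℝ) ≤ s₀) ∧
      Tendsto (fun k => (u k : ℝ≥0∞)) atTop (nhds (ENNReal.ofReal s₀)) := by
    -- The energy estimate needs `s < γ` strictly, whereas `s₀ = γ` when `ν = ρ`; hence the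
    -- approximation of `s₀` from below.
    refine ⟨fun k => (min s₀ (γ - γ / (k + 1 : ℝ))).toNNReal, fun k => ?_, ?_⟩
    · have h1 : 0 ≤ γ - γ / (k + 1 : ℝ) := by
        rw [sub_nonneg]
        exact div_le_self hγ.le (by linarith [Nat.cast_nonneg (α := ℝ) k])
      rw [Real.coe_toNNReal _ (le_min hs₀nonneg h1)]
      have h2 : 0 < γ / (k + 1 : ℝ) := by positivity
      exact ⟨(min_le_right _ _).trans_lt (by linarith), min_le_left _ _⟩
    · have h1 : Tendsto (fun k : ℕ => γ - γ / (k + 1 : ℝ)) atTop (nhds (γ - 0)) := by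
        have := (tendsto_one_div_add_atTop_nhds_zero_nat (𝕜 := ℝ)).const_mul γ
        simp only [mul_zero, mul_one_div] at this
        exact this.const_sub γ
      have h2 := ENNReal.tendsto_ofReal ((tendsto_const_nhds (x := s₀)).min h1)
      rwa [sub_zero, min_eq_left hs₀γ] at h2
  filter_upwards [ae_all_iff.2 fun k => hlower (u k) (hu k).1 (hu k).2,
    ae_dimH_approxExponent_le hX hunif hr hρ hconv hne hG hν hνγ] with ω h1 h2
  have hdim : dimH {ξ ∈ G | ENNReal.ofReal ν ≤ approxExponent (fun n => X n ω) r ξ} =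
      ENNReal.ofReal s₀ := le_antisymm h2 (le_of_tendsto' hulim fun k => (h1 k).2)
  rw [hausdorffDim, if_neg (h1 0).1.ne_empty, hdim, EReal.coe_ennreal_ofReal,
    max_eq_left hs₀nonneg]
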